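/- **Model.** Let $n,p,q,r\ge 1$. Observe $(\mathbf x_i,\mathbf y_i)$, $i=1,\dots,n$, with $y_{ij}=f_j(\mathbf B^\top \mathbf x_i)+\epsilon_{ij}$, $j=1,\dots,q$, where the $\mathbf x_i$ are i.i.d. $\mathcal N(0,\mathbf\Sigma)$ in $\mathbb R^p$ with $\mathbf\Sigma$ positive definite, $\mathbf B\in\mathbb R^{p\times r}$ has rank $r$, the noise variables $\epsilon_{ij}$ are i.i.d., centred, of finite variance and independent of the $\mathbf x_i$, and the links $f_j:\mathbb R^r\to\mathbb R$ are differentiable. Write $\mathbf z=\mathbf B^\top\mathbf x$ and $\mathbf z_i=\mathbf B^\top\mathbf x_i$; assume $\nabla f_j(\mathbf z)$ is integrable and let $\mathbf M_1=\mathbb E\{\nabla f_1(\mathbf z),\dots,\nabla f_q(\mathbf z)\}\in\mathbb R^{r\times q}$. **Estimators.** For a matrix $\mathbf A$ let $\mathrm{SVD}_{l,r}(\mathbf A)$ be a matrix whose columns are the top $r$ left singular vectors in a singular value decomposition of $\mathbf A$ (any choice, if it is not unique). Let $\mathbf s(\mathbf x)=-\nabla\ln P(\mathbf x)=\mathbf\Sigma^{-1}\mathbf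 x$ be the score of the density $P$ of $\mathcal N(0,\mathbf\Sigma)$, $\widehat{\mathbf\Sigma}=\frac1n\sum_i\mathbf x_i\mathbf x_i^\top$ and $\hat{\mathbf s}(\mathbf x)=\widehat{\mathbf\Sigma}^{\dagger}\mathbf x$ with the Moore–Penrose pseudo-inverse. Put $$\widehat{\mathbf B}=\mathrm{SVD}_{l,r}\Big\{\tfrac1n\sum_{i=1}^n\mathbf s(\mathbf x_i)\mathbf y_i^\top\Big\},\qquad \check{\mathbf B}=\mathrm{SVD}_{l,r}\Big\{\tfrac1n\sum_{i=1}^n\hat{\mathbf s}(\mathbf x_i)\mathbf y_i^\top\Big\}.$$ **Assumptions.** There are constants $c_\Sigma,c_B,c_M>0$ and $C_f,C_h,\sigma$, not depending on $n,p,q,r$, such that: $\lambda_{\min}(\mathbf\Sigma)\ge c_\Sigma$; $\sigma_r(\mathbf B)\ge c_B$; $\sigma_r(\mathbf M_1)\ge c_M\sqrt{q/r}$; $[\mathbb E f_j(\mathbf z)^4]^{1/4}\le C_f$ for all $j$; $(\mathbb E\epsilon_{ij}^2)^{1/2}\le\sigma$; and $f_j(\mathbf z)=f_j(0)+\langle\nabla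 f_j(0),\mathbf z\rangle+h_j(\mathbf z)\|\mathbf z\|_2$ with $h_j(\mathbf z)\to0$ as $\mathbf z\to0$, and, almost surely, $|h_j(\mathbf z_i)|\le C_h$ for all $i,j$. **Conclusion.** $\inf_{\mathbf V}\|\widehat{\mathbf B}-\check{\mathbf B}\mathbf V\|_F=\mathcal O_p\big(\sqrt{r^2p/n}\big)$, the infimum being over orthogonal $\mathbf V\in\mathbb R^{r\times r}$, uniformly over the dimensions and models: for every $\delta>0$ there is $K>0$, depending only on $\delta$ and the constants above, such that for all $n,p,q,r\ge1$ and all such models $$\mathbb P\Big(\inf_{\mathbf V}\|\widehat{\mathbf B}-\check{\mathbf B}\mathbf V\|_F>K\sqrt{r^2p/n}\Big)\le\delta .$$ -/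

import Mathlib

open MeasureTheory ProbabilityTheory Filter Topology
open scoped Matrix Gradient ENNReal

noncomputable section

/-- The first-order (Stein) score `s(x) = -∇ ln P(x)` of a density `P` on `ℝᵖ`. -/
def firstOrderScore {p : ℕ} (P : EuclideanSpace ℝ (Fin p) → ℝ) (x : EuclideanSpace ℝ (Fin p)) :
    EuclideanSpace ℝ (Fin p) :=
  -∇ (fun u => Real.log (P u)) x

/-- The Lebesgue density of the centred normal law `N(0, S)`. -/
def gaussianDensity {p : ℕ} (S : Matrix (Fin p) (Fin p) ℝ) (x : EuclideanSpace ℝ (Fin p)) : ℝ :=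
  (√((2 * Real.pi) ^ p * S.det))⁻¹ * Real.exp (-(1 / 2) * inner ℝ x (S⁻¹.toEuclideanLin x))

/-- The score of `N(0, S)` is `x ↦ S⁻¹ x`. -/
theorem firstOrderScore_gaussianDensity {p : ℕ} {S : Matrix (Fin p) (Fin p) ℝ} (hS : S.PosDef)
    (x : EuclideanSpace ℝ (Fin p)) :
    firstOrderScore (gaussianDensity S) x = S⁻¹.toEuclideanLin x := by
  set T : EuclideanSpace ℝ (Fin p) →L[ℝ] EuclideanSpace ℝ (Fin p) :=
    LinearMap.toContinuousLinearMap S⁻¹.toEuclideanLin with hT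
  have hc : 0 < (√((2 * Real.pi) ^ p * S.det))⁻¹ := by
    have := hS.det_pos
    positivity
  have hlog : (fun u => Real.log (gaussianDensity S u)) = fun u =>
      Real.log (√((2 * Real.pi) ^ p * S.det))⁻¹ + -(1 / 2) * inner ℝ u (T u) := by
    funext u
    rw [gaussianDensity, Real.log_mul hc.ne' (Real.exp_pos _).ne', Real.log_exp]
    rfl
  have hsym : ∀ u v : EuclideanSpace ℝ (Fin p), inner ℝ u (T v) = inner ℝ (T u) v := by
    have h1 := Matrix.isSymmetric_toEuclideanLin_iff.mpr hS.isHermitian.inv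
    intro u v
    exact (h1 u v).symm
  have hd : HasGradientAt (fun u => Real.log (gaussianDensity S u)) (-(T x)) x := by
    rw [hlog, hasGradientAt_iff_hasFDerivAt]
    have h2 := (((hasFDerivAt_id (𝕜 := ℝ) x).inner ℝ (T.hasFDerivAt (x := x))).const_mul
      (-(1 / 2) : ℝ)).const_add (Real.log (√((2 * Real.pi) ^ p * S.det))⁻¹)
    refine h2.congr_fderiv (ContinuousLinearMap.ext fun v => ?_)
    simp [fderivInnerCLM_apply, hsym]
    rw [← hsym v x, real_inner_comm (T x) v]
    ring
  rw [firstOrderScore, hd.gradient, neg_neg]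
  rfl

/-- The uncentred sample covariance matrix `(1/n) ∑ᵢ xᵢ xᵢᵀ`. -/
def sampleCov {n p : ℕ} (x : Fin n → EuclideanSpace ℝ (Fin p)) : Matrix (Fin p) (Fin p) ℝ :=
  (1 / (n : ℝ)) • ∑ i, Matrix.vecMulVec (x i).ofLp (x i).ofLp

/-- `A'` is the Moore-Penrose pseudo-inverse of the square matrix `A`
(the four Penrose equations, which determine `A'` uniquely). -/
def IsMoorePenroseInverse {p : ℕ} (A A' : Matrix (Fin p) (Fin p) ℝ) : Prop :=
  A * A' * A = A ∧ A' * A * A' = A' ∧ (A * A')ᵀ = A * A' ∧ (A' * A)ᵀ = A' * A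

/-- The matrix `(1/n) ∑ᵢ s(xᵢ) yᵢᵀ` for a (true or estimated) score `s`. -/
def scoreCrossMoment {n p q : ℕ} (s : EuclideanSpace ℝ (Fin p) → EuclideanSpace ℝ (Fin p))
    (x : Fin n → EuclideanSpace ℝ (Fin p)) (y : Fin n → Fin q → ℝ) :
    Matrix (Fin p) (Fin q) ℝ :=
  (1 / (n : ℝ)) • ∑ i, Matrix.vecMulVec (s (x i)).ofLp (y i)

/-- `W = SVD_{l,r}(A)`: the columns of `W` are the top `r` left singular vectors in some
singular value decomposition `A = U D Vᵀ`, with `U`, `V` orthogonal and `D` rectangular diagonal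
with nonnegative nonincreasing diagonal. -/
def IsTopLeftSingularVectors {p q r : ℕ} (A : Matrix (Fin p) (Fin q) ℝ)
    (W : Matrix (Fin p) (Fin r) ℝ) : Prop :=
  ∃ U ∈ Matrix.orthogonalGroup (Fin p) ℝ, ∃ V ∈ Matrix.orthogonalGroup (Fin q) ℝ, ∃ d : ℕ → ℝ,
    Antitone d ∧ (∀ k, 0 ≤ d k) ∧
    A = U * (Matrix.of fun (i : Fin p) (j : Fin q) => if (i : ℕ) = (j : ℕ) then d i else 0) * Vᵀ ∧
    ∃ h : r ≤ p, W = U.submatrix id (Fin.castLE h)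

/-- `Bhat` is the first-order estimator computed with the true score of `N(0, S)`. -/
def IsFirstOrderEstimator {n p q r : ℕ} (S : Matrix (Fin p) (Fin p) ℝ)
    (x : Fin n → EuclideanSpace ℝ (Fin p)) (y : Fin n → Fin q → ℝ)
    (Bhat : Matrix (Fin p) (Fin r) ℝ) : Prop :=
  IsTopLeftSingularVectors (scoreCrossMoment (firstOrderScore (gaussianDensity S)) x y) Bhat

/-- `Bcheck` is the plug-in first-order estimator: the score is replaced by `u ↦ A u` with `A` the
pseudo-inverse of the sample covariance matrix. -/
def IsPlugInEstimator {n p q r : ℕ}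
    (x : Fin n → EuclideanSpace ℝ (Fin p)) (y : Fin n → Fin q → ℝ)
    (Bcheck : Matrix (Fin p) (Fin r) ℝ) : Prop :=
  ∃ A, IsMoorePenroseInverse (sampleCov x) A ∧
    IsTopLeftSingularVectors (scoreCrossMoment (fun u => A.toEuclideanLin u) x y) Bcheck

open scoped Matrix.Norms.Frobenius in
/-- The Frobenius norm of a matrix. -/
def frobNorm {p r : ℕ} (A : Matrix (Fin p) (Fin r) ℝ) : ℝ := ‖A‖

/-- The column space distance `inf_V ‖Θ₁ - Θ₂ V‖_F` over orthogonal `V`. -/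
def columnDist {p r : ℕ} (T₁ T₂ : Matrix (Fin p) (Fin r) ℝ) : ℝ :=
  ⨅ V : Matrix.orthogonalGroup (Fin r) ℝ, frobNorm (T₁ - T₂ * (V : Matrix (Fin r) (Fin r) ℝ))

/-- The `k`-th largest singular value of a matrix, `k = 1, 2, …`. -/
def singularValue {m n : ℕ} (A : Matrix (Fin m) (Fin n) ℝ) (k : ℕ) : ℝ :=
  A.toEuclideanLin.singularValues (k - 1)

/-- The latent variable `z = Bᵀ x`. -/
def latent {p r : ℕ} (B : Matrix (Fin p) (Fin r) ℝ) (x : EuclideanSpace ℝ (Fin p)) :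
    EuclideanSpace ℝ (Fin r) :=
  Bᵀ.toEuclideanLin x

/-- The `r × q` matrix whose `j`-th column is `E ∇f_j(Bᵀ x)`, for `x ∼ N(0, S)`. -/
def meanGradient {p q r : ℕ} (S : Matrix (Fin p) (Fin p) ℝ) (B : Matrix (Fin p) (Fin r) ℝ)
    (f : Fin q → EuclideanSpace ℝ (Fin r) → ℝ) : Matrix (Fin r) (Fin q) ℝ :=
  Matrix.of fun k j => (∫ x, ∇ (f j) (latent B x) ∂(multivariateGaussian 0 S)) k

/-- A sample of size `n` from the nonlinear multiple response model
`y_j = f_j(Bᵀ x) + ε_j`, `j = 1, …, q`, with i.i.d. features `x ∼ N(0, S)` and independent noise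
whose components are i.i.d. with centred law `ν`. -/
structure IsModelSample {Ω : Type*} [MeasurableSpace Ω] (μ : Measure Ω) {n p q r : ℕ}
    (S : Matrix (Fin p) (Fin p) ℝ) (B : Matrix (Fin p) (Fin r) ℝ)
    (f : Fin q → EuclideanSpace ℝ (Fin r) → ℝ) (ν : Measure ℝ)
    (x : Fin n → Ω → EuclideanSpace ℝ (Fin p)) (e : Fin n → Fin q → Ω → ℝ)
    (y : Fin n → Ω → Fin q → ℝ) : Prop where
  law_x : ∀ i, HasLaw (x i) (multivariateGaussian 0 S) μ
  indep_x : iIndepFun x μ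
  law_noise : ∀ i j, HasLaw (e i j) ν μ
  indep_noise : iIndepFun (fun ij : Fin n × Fin q => e ij.1 ij.2) μ
  integrable_noise : Integrable id ν
  mean_noise : ∫ t, t ∂ν = 0
  indep_x_noise : IndepFun (fun ω i => x i ω) (fun ω (ij : Fin n × Fin q) => e ij.1 ij.2 ω) μ
  response : ∀ᵐ ω ∂μ, ∀ i j, y i ω j = f j (latent B (x i ω)) + e i j ω

end

/-!
Write `A₀ = B M₁`, a matrix of rank `r` whose smallest nonzero singular value is at least
`cB cM √(q/r)`. Both estimators are top left singular vectors of a perturbation of `A₀`, so it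
suffices to show that each of the two cross moments is within `O(√(qp/n))` of `A₀` in Frobenius
norm, with high probability.

*Linear algebra.* Ky Fan's maximum principle (`IsTopLeftSingularVectors.frobNorm_transpose_mul_le`)
gives a sine theorem (`IsTopLeftSingularVectors.sin_le`) for each estimator against the column space
of `A₀`. The two sines bound the Procrustes distance through the polar factor of `W₂ᵀ W₁`
(`columnDist_le_mul_sin`); the factor `√r` given away there turns `√(rp/n)` into `√(r²p/n)`.

*Whitening and Stein's identity.* With `R` the square root of the covariance matrix `S` and
`x = R w`, the vectors `wᵢ` are standard Gaussian, and Stein's identity says that column `j` of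
`R A₀` is `bⱼ = E[w Fⱼ(w)]`, where `Fⱼ(w) = fⱼ(Bᵀ R w)` (`integral_coord_mul_link`). The error of the
cross moment with the true score is then, up to `R`, the error of a sample mean. The plug-in cross
moment is the least-squares estimator, so its error is the inverse of the whitened Gram matrix
applied to the sample mean of `w (Fⱼ(w) - ⟨bⱼ, w⟩ + εⱼ)`, which is again centred
(`frobNorm_plugIn_sub_le`). All these means have mean square `O(1/n)` per entry by fourth moments,
whence `O(qp/n)` in total (`exists_whitened_errors`).

*Conditioning.* The Gram matrix has smallest eigenvalue at least `1/80` except with probability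
`2 exp (-n/8)` as soon as `n ≥ 50 p` (`measure_exists_sum_inner_sq_lt`). Instead of a covering
argument, the Laplace transform of `∑ᵢ ⟨u, wᵢ⟩²` is integrated over a ball of directions `u`, and a
bad direction makes this integral large. When `n` is less than a constant times `p`, the claim
follows from the trivial bound `2√r` on the distance.
-/

/-! ### The Frobenius norm -/

section FrobeniusNorm

variable {l m n p q r : ℕ}

open scoped Matrix.Norms.Frobenius in
theorem frobNorm_nonneg (A : Matrix (Fin m) (Fin n) ℝ) : 0 ≤ frobNorm A := norm_nonneg A

open scoped Matrix.Norms.Frobenius in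
theorem frobNorm_add_le (A B : Matrix (Fin m) (Fin n) ℝ) :
    frobNorm (A + B) ≤ frobNorm A + frobNorm B := norm_add_le A B

open scoped Matrix.Norms.Frobenius in
theorem frobNorm_sub_le (A B : Matrix (Fin m) (Fin n) ℝ) :
    frobNorm (A - B) ≤ frobNorm A + frobNorm B := norm_sub_le A B

open scoped Matrix.Norms.Frobenius in
theorem frobNorm_neg (A : Matrix (Fin m) (Fin n) ℝ) : frobNorm (-A) = frobNorm A := norm_neg A

open scoped Matrix.Norms.Frobenius in
theorem frobNorm_mul_le (A : Matrix (Fin l) (Fin m) ℝ) (B : Matrix (Fin m) (Fin n) ℝ) :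
    frobNorm (A * B) ≤ frobNorm A * frobNorm B := Matrix.frobenius_norm_mul A B

open scoped Matrix.Norms.Frobenius in
theorem frobNorm_transpose (A : Matrix (Fin m) (Fin n) ℝ) : frobNorm Aᵀ = frobNorm A :=
  Matrix.frobenius_norm_transpose A

open scoped Matrix.Norms.Frobenius in
theorem frobNorm_sq (A : Matrix (Fin m) (Fin n) ℝ) :
    frobNorm A ^ 2 = ∑ i, ∑ j, A i j ^ 2 := by
  have h0 : 0 ≤ ∑ i, ∑ j, A i j ^ 2 := by positivity
  rw [frobNorm, Matrix.frobenius_norm_def]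
  simp only [Real.norm_eq_abs, ← Real.sqrt_eq_rpow, Real.rpow_ofNat, sq_abs]
  exact Real.sq_sqrt h0

theorem frobNorm_sq_eq_trace (A : Matrix (Fin m) (Fin n) ℝ) :
    frobNorm A ^ 2 = (Aᵀ * A).trace := by
  rw [frobNorm_sq, Finset.sum_comm]
  simp [Matrix.trace, Matrix.mul_apply, sq]

theorem frobNorm_sq_eq_sum_col (A : Matrix (Fin m) (Fin n) ℝ) :
    frobNorm A ^ 2 = ∑ j, ∑ i, A i j ^ 2 := by
  rw [frobNorm_sq, Finset.sum_comm]

theorem frobNorm_orthonormal_mul {W : Matrix (Fin m) (Fin l) ℝ} (hW : Wᵀ * W = 1)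
    (A : Matrix (Fin l) (Fin n) ℝ) : frobNorm (W * A) = frobNorm A := by
  refine (sq_eq_sq₀ (frobNorm_nonneg _) (frobNorm_nonneg _)).1 ?_
  rw [frobNorm_sq_eq_trace, frobNorm_sq_eq_trace, Matrix.transpose_mul, Matrix.mul_assoc,
    ← Matrix.mul_assoc Wᵀ, hW, Matrix.one_mul]

theorem frobNorm_mul_orthonormal_transpose {W : Matrix (Fin m) (Fin l) ℝ} (hW : Wᵀ * W = 1)
    (A : Matrix (Fin n) (Fin l) ℝ) : frobNorm (A * Wᵀ) = frobNorm A := by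
  rw [← frobNorm_transpose, Matrix.transpose_mul, Matrix.transpose_transpose,
    frobNorm_orthonormal_mul hW, frobNorm_transpose]

theorem frobNorm_sq_orthonormal {W : Matrix (Fin m) (Fin r) ℝ} (hW : Wᵀ * W = 1) :
    frobNorm W ^ 2 = r := by
  rw [frobNorm_sq_eq_trace, hW, Matrix.trace_one, Fintype.card_fin]

theorem proj_compl_transpose_mul_self {W : Matrix (Fin p) (Fin r) ℝ} (hW : Wᵀ * W = 1) :
    (1 - W * Wᵀ)ᵀ * (1 - W * Wᵀ) = 1 - W * Wᵀ := by
  have h : W * Wᵀ * (W * Wᵀ) = W * Wᵀ := by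
    rw [Matrix.mul_assoc, ← Matrix.mul_assoc Wᵀ, hW, Matrix.one_mul]
  rw [Matrix.transpose_sub, Matrix.transpose_mul, Matrix.transpose_transpose,
    Matrix.transpose_one, Matrix.mul_sub, Matrix.sub_mul 1 (W * Wᵀ) (W * Wᵀ), Matrix.mul_one,
    h, Matrix.one_mul, sub_self, sub_zero]

/-- Pythagoras for the orthogonal projection `W Wᵀ` onto the column space of `W`. -/
theorem frobNorm_sq_eq_add {W : Matrix (Fin p) (Fin r) ℝ} (hW : Wᵀ * W = 1)
    (A : Matrix (Fin p) (Fin n) ℝ) :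
    frobNorm A ^ 2 = frobNorm (Wᵀ * A) ^ 2 + frobNorm ((1 - W * Wᵀ) * A) ^ 2 := by
  simp only [frobNorm_sq_eq_trace]
  rw [Matrix.transpose_mul (1 - W * Wᵀ), Matrix.mul_assoc Aᵀ, ← Matrix.mul_assoc (1 - W * Wᵀ)ᵀ,
    proj_compl_transpose_mul_self hW, ← Matrix.trace_add, Matrix.transpose_mul,
    Matrix.transpose_transpose, Matrix.mul_assoc Aᵀ, ← Matrix.mul_add, ← Matrix.mul_assoc W,
    ← Matrix.add_mul, add_sub_cancel, Matrix.one_mul]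

theorem frobNorm_proj_compl_mul_le {W : Matrix (Fin p) (Fin r) ℝ} (hW : Wᵀ * W = 1)
    (A : Matrix (Fin p) (Fin n) ℝ) : frobNorm ((1 - W * Wᵀ) * A) ≤ frobNorm A := by
  refine (sq_le_sq₀ (frobNorm_nonneg _) (frobNorm_nonneg _)).1 ?_
  rw [frobNorm_sq_eq_add hW A]
  nlinarith [sq_nonneg (frobNorm (Wᵀ * A))]

theorem mul_frobNorm_sq_le {M : Matrix (Fin m) (Fin n) ℝ} {c : ℝ}
    (h : ∀ v, c * (v ⬝ᵥ v) ≤ (v ᵥ* M) ⬝ᵥ (v ᵥ* M)) (X : Matrix (Fin l) (Fin m) ℝ) :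
    c * frobNorm X ^ 2 ≤ frobNorm (X * M) ^ 2 := by
  rw [frobNorm_sq, frobNorm_sq, Finset.mul_sum]
  refine Finset.sum_le_sum fun i _ => ?_
  have h1 := h (X i)
  simpa [dotProduct, ← sq, Matrix.vecMul, Matrix.mul_apply] using h1

theorem mul_frobNorm_le {M : Matrix (Fin m) (Fin n) ℝ} {c : ℝ} (hc : 0 ≤ c)
    (h : ∀ v, c ^ 2 * (v ⬝ᵥ v) ≤ (v ᵥ* M) ⬝ᵥ (v ᵥ* M)) (X : Matrix (Fin l) (Fin m) ℝ) :
    c * frobNorm X ≤ frobNorm (X * M) := by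
  refine (sq_le_sq₀ (mul_nonneg hc (frobNorm_nonneg _)) (frobNorm_nonneg _)).1 ?_
  rw [mul_pow]
  exact mul_frobNorm_sq_le h X

end FrobeniusNorm

/-! ### Distance between column spaces -/

section ColumnDist

variable {m n p q r : ℕ}

theorem columnDist_le (T₁ T₂ : Matrix (Fin p) (Fin r) ℝ) {V : Matrix (Fin r) (Fin r) ℝ}
    (hV : V ∈ Matrix.orthogonalGroup (Fin r) ℝ) : columnDist T₁ T₂ ≤ frobNorm (T₁ - T₂ * V) :=
  ciInf_le (f := fun V : Matrix.orthogonalGroup (Fin r) ℝ =>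
    frobNorm (T₁ - T₂ * (V : Matrix (Fin r) (Fin r) ℝ)))
    ⟨0, by rintro _ ⟨V, rfl⟩; exact frobNorm_nonneg _⟩ ⟨V, hV⟩

theorem columnDist_le_two_mul_sqrt {W₁ W₂ : Matrix (Fin p) (Fin r) ℝ} (h₁ : W₁ᵀ * W₁ = 1)
    (h₂ : W₂ᵀ * W₂ = 1) : columnDist W₁ W₂ ≤ 2 * √r := by
  have h := columnDist_le W₁ W₂ (one_mem (Matrix.orthogonalGroup (Fin r) ℝ))
  have e : ∀ W : Matrix (Fin p) (Fin r) ℝ, Wᵀ * W = 1 → frobNorm W = √r := fun W hW => by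
    rw [← frobNorm_sq_orthonormal hW, Real.sqrt_sq (frobNorm_nonneg _)]
  rw [Matrix.mul_one] at h
  have := frobNorm_sub_le W₁ W₂
  rw [e _ h₁, e _ h₂] at this
  linarith

theorem dotProduct_mulVec_self (M : Matrix (Fin m) (Fin n) ℝ) (v : Fin n → ℝ) :
    (M *ᵥ v) ⬝ᵥ (M *ᵥ v) = v ⬝ᵥ ((Mᵀ * M) *ᵥ v) := by
  rw [← Matrix.mulVec_mulVec, Matrix.dotProduct_mulVec v, Matrix.vecMul_transpose]

theorem dotProduct_self_pos {v : Fin n → ℝ} (hv : v ≠ 0) : 0 < v ⬝ᵥ v := by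
  simpa using Matrix.dotProduct_star_self_pos_iff.2 hv

theorem dotProduct_self_nonneg' (v : Fin n → ℝ) : 0 ≤ v ⬝ᵥ v := by
  simpa using dotProduct_star_self_nonneg v

open scoped MatrixOrder in
/-- Polar decomposition `N = U R` of a matrix with injective action: `U` has orthonormal columns
and `R = (NᵀN)^{1/2}`. -/
theorem exists_polar (N : Matrix (Fin m) (Fin r) ℝ) {c : ℝ} (hc : 0 < c)
    (hN : ∀ v, c * (v ⬝ᵥ v) ≤ (N *ᵥ v) ⬝ᵥ (N *ᵥ v)) :
    ∃ (U : Matrix (Fin m) (Fin r) ℝ) (R : Matrix (Fin r) (Fin r) ℝ),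
      Uᵀ * U = 1 ∧ N = U * R ∧ R.PosSemidef ∧ R * R = Nᵀ * N := by
  have hH : (Nᵀ * N).PosDef := by
    refine Matrix.PosDef.of_dotProduct_mulVec_pos ?_ fun v hv => ?_
    · have := Matrix.isHermitian_conjTranspose_mul_self N
      simpa using this
    · have h1 := hN v
      rw [dotProduct_mulVec_self] at h1
      have := dotProduct_self_pos hv
      simp only [star_trivial]
      nlinarith
  set R := CFC.sqrt (Nᵀ * N) with hR
  have hRp : R.PosSemidef := Matrix.nonneg_iff_posSemidef.1 (CFC.sqrt_nonneg _)
  have hRR : R * R = Nᵀ * N := CFC.sqrt_mul_sqrt_self _ hH.posSemidef.nonneg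
  have hdet : IsUnit R.det := by
    have h1 := hH.det_pos
    rw [← hRR, Matrix.det_mul] at h1
    exact isUnit_iff_ne_zero.2 fun h => by simp [h] at h1
  have hRt : Rᵀ = R := by simpa using hRp.isHermitian.eq
  refine ⟨N * R⁻¹, R, ?_, ?_, hRp, hRR⟩
  · rw [Matrix.transpose_mul, Matrix.transpose_nonsing_inv, hRt, Matrix.mul_assoc,
      ← Matrix.mul_assoc Nᵀ, ← hRR, Matrix.mul_assoc, Matrix.mul_nonsing_inv _ hdet,
      Matrix.mul_one, Matrix.nonsing_inv_mul _ hdet]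
  · rw [Matrix.mul_assoc, Matrix.nonsing_inv_mul _ hdet, Matrix.mul_one]

/-- Procrustes: up to the factor `√r`, the column-space distance is bounded by the sine distance
`a = ‖(1 - W₂W₂ᵀ) W₁‖_F`. For `a < 1` the polar factor of `W₂ᵀ W₁` is at distance at most `2a`, with
no `√r`; the factor only serves the case `a ≥ 1`, where the trivial bound `2√r` is used. -/
theorem columnDist_le_mul_sin (hr : 0 < r) {W₁ W₂ : Matrix (Fin p) (Fin r) ℝ}
    (h₁ : W₁ᵀ * W₁ = 1) (h₂ : W₂ᵀ * W₂ = 1) :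
    columnDist W₁ W₂ ≤ 2 * √r * frobNorm ((1 - W₂ * W₂ᵀ) * W₁) := by
  set C := (1 - W₂ * W₂ᵀ) * W₁ with hC
  set a := frobNorm C with ha
  have ha0 : 0 ≤ a := frobNorm_nonneg _
  have hr1 : (1 : ℝ) ≤ √r := Real.one_le_sqrt.2 (by exact_mod_cast hr)
  -- for `a ≥ 1` the polar factor need not exist
  rcases le_or_gt 1 a with h | h
  · refine (columnDist_le_two_mul_sqrt h₁ h₂).trans ?_
    nlinarith
  set N := W₂ᵀ * W₁ with hN
  have hNC : Nᵀ * N = 1 - Cᵀ * C := by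
    have e : Cᵀ * C = W₁ᵀ * ((1 - W₂ * W₂ᵀ) * W₁) := by
      rw [hC, Matrix.transpose_mul, Matrix.mul_assoc, ← Matrix.mul_assoc (1 - W₂ * W₂ᵀ)ᵀ,
        proj_compl_transpose_mul_self h₂]
    rw [e, hN, Matrix.transpose_mul, Matrix.transpose_transpose, Matrix.sub_mul, Matrix.mul_sub,
      Matrix.one_mul, h₁]
    simp only [Matrix.mul_assoc, sub_sub_cancel]
  have hCv : ∀ v, (C *ᵥ v) ⬝ᵥ (C *ᵥ v) ≤ a ^ 2 * (v ⬝ᵥ v) := fun v => by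
    have h3 := frobNorm_mul_le C (Matrix.replicateCol (Fin 1) v)
    have h4 : (frobNorm (C * Matrix.replicateCol (Fin 1) v)) ^ 2
        ≤ (frobNorm C * frobNorm (Matrix.replicateCol (Fin 1) v)) ^ 2 := by
      gcongr
      exact frobNorm_nonneg _
    rw [mul_pow, frobNorm_sq, frobNorm_sq (Matrix.replicateCol _ _)] at h4
    simpa [dotProduct, ← sq, Matrix.mulVec, Matrix.mul_apply] using h4
  obtain ⟨U, R, hU, hUR, hRp, hRR⟩ := exists_polar N (c := 1 - a ^ 2) (by nlinarith) fun v => by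
    rw [dotProduct_mulVec_self N, hNC, Matrix.sub_mulVec, Matrix.one_mulVec, dotProduct_sub,
      ← dotProduct_mulVec_self]
    linarith [hCv v]
  have hRt : Rᵀ = R := by simpa using hRp.isHermitian.eq
  -- `(R - 1)(R + 1) = R² - 1 = -CᵀC` and `R + 1 ≥ 1`
  have hR1 : frobNorm (R - 1) ≤ a ^ 2 := by
    have h5 : (R - 1) * (R + 1) = -(Cᵀ * C) := by
      rw [Matrix.sub_mul, Matrix.mul_add, hRR, hNC, Matrix.one_mul, Matrix.mul_one]
      abel
    have h6 := mul_frobNorm_le (M := R + 1) (c := 1) zero_le_one (fun v => by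
      rw [Matrix.vecMul_add, Matrix.vecMul_one, ← Matrix.mulVec_transpose, hRt]
      have h7 := hRp.dotProduct_mulVec_nonneg v
      simp only [star_trivial] at h7
      have h8 := dotProduct_self_nonneg' (R *ᵥ v)
      rw [add_dotProduct, dotProduct_add, dotProduct_add, dotProduct_comm (R *ᵥ v) v]
      linarith) (R - 1)
    rw [h5, frobNorm_neg, one_mul] at h6
    refine h6.trans ((frobNorm_mul_le _ _).trans ?_)
    rw [frobNorm_transpose, sq]
  have hUo : U ∈ Matrix.orthogonalGroup (Fin r) ℝ := (Matrix.mem_orthogonalGroup_iff' _ _).2 hU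
  have e : W₁ - W₂ * U = C + W₂ * (U * (R - 1)) := by
    rw [Matrix.mul_sub, Matrix.mul_one, ← hUR, hC, hN, Matrix.mul_sub, Matrix.sub_mul,
      Matrix.one_mul, Matrix.mul_assoc]
    abel
  have h9 := columnDist_le W₁ W₂ hUo
  rw [e] at h9
  have h10 := frobNorm_add_le C (W₂ * (U * (R - 1)))
  rw [frobNorm_orthonormal_mul h₂, frobNorm_orthonormal_mul hU] at h10
  nlinarith

end ColumnDist

/-! ### Perturbation of top singular vectors -/

section SingularVectors

variable {p q r : ℕ}

theorem IsTopLeftSingularVectors.orthonormal {A : Matrix (Fin p) (Fin q) ℝ}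
    {W : Matrix (Fin p) (Fin r) ℝ} (h : IsTopLeftSingularVectors A W) : Wᵀ * W = 1 := by
  obtain ⟨U, hU, V, hV, d, hd, hd0, hA, hrp, rfl⟩ := h
  have hU' := (Matrix.mem_orthogonalGroup_iff' _ _).1 hU
  ext a b
  have := congrFun (congrFun hU' (Fin.castLE hrp a)) (Fin.castLE hrp b)
  simp only [Matrix.mul_apply, Matrix.transpose_apply, Matrix.submatrix_apply, id] at this ⊢
  erw [this]
  simp [Matrix.one_apply]

/-- A weighted sum of antitone weights is largest when the unit masses sit on the top weights. -/
theorem sum_mul_le_sum_filter_lt {s t : Fin p → ℝ} (hs : Antitone s) (ht0 : ∀ i, 0 ≤ t i)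
    (ht1 : ∀ i, t i ≤ 1) (hrp : r ≤ p) (ht : ∑ i, t i = r) :
    ∑ i, s i * t i ≤ ∑ i, s i * (if (i : ℕ) < r then 1 else 0) := by
  rcases Nat.eq_zero_or_pos r with rfl | hr
  · have : ∀ i, t i = 0 := fun i =>
      (Finset.sum_eq_zero_iff_of_nonneg fun i _ => ht0 i).1 (by simpa using ht) i (Finset.mem_univ i)
    simp [this]
  set k : Fin p := ⟨r - 1, by omega⟩ with hk
  have hcount : ∑ i : Fin p, (if (i : ℕ) < r then (1 : ℝ) else 0) = r := by
    rw [Finset.sum_boole, Fin.card_filter_val_lt, min_eq_right hrp]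
  have key : 0 ≤ ∑ i, (s i - s k) * ((if (i : ℕ) < r then (1 : ℝ) else 0) - t i) := by
    refine Finset.sum_nonneg fun i _ => ?_
    split_ifs with hi
    · exact mul_nonneg (sub_nonneg.2 (hs (by rw [Fin.le_def]; simp only [hk]; omega)))
        (by linarith [ht1 i])
    · exact mul_nonneg_of_nonpos_of_nonpos
        (sub_nonpos.2 (hs (by rw [Fin.le_def]; simp only [hk]; omega))) (by linarith [ht0 i])
  have e : ∑ i, (s i - s k) * ((if (i : ℕ) < r then (1 : ℝ) else 0) - t i)
      = (∑ i, s i * (if (i : ℕ) < r then 1 else 0) - ∑ i, s i * t i)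
        - s k * (∑ i : Fin p, (if (i : ℕ) < r then (1 : ℝ) else 0) - ∑ i, t i) := by
    rw [← Finset.sum_sub_distrib, ← Finset.sum_sub_distrib, Finset.mul_sum,
      ← Finset.sum_sub_distrib]
    exact Finset.sum_congr rfl fun i _ => by ring
  rw [e, hcount, ht] at key
  linarith

/-- Ky Fan's maximum principle: the top left singular vectors capture at least as much of `A`, in
Frobenius norm, as any other orthonormal system of the same size. -/
theorem IsTopLeftSingularVectors.frobNorm_transpose_mul_le {A : Matrix (Fin p) (Fin q) ℝ}
    {W Q : Matrix (Fin p) (Fin r) ℝ} (h : IsTopLeftSingularVectors A W) (hQ : Qᵀ * Q = 1) :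
    frobNorm (Qᵀ * A) ^ 2 ≤ frobNorm (Wᵀ * A) ^ 2 := by
  have hW := h.orthonormal
  obtain ⟨U, hU, V, hV, d, hd, hd0, hA, hrp, hWU⟩ := h
  have hU' := (Matrix.mem_orthogonalGroup_iff' _ _).1 hU
  have hU'' := (Matrix.mem_orthogonalGroup_iff _ _).1 hU
  have hV' := (Matrix.mem_orthogonalGroup_iff' _ _).1 hV
  set D : Matrix (Fin p) (Fin q) ℝ :=
    Matrix.of fun (i : Fin p) (j : Fin q) => if (i : ℕ) = (j : ℕ) then d i else 0 with hD
  set s : Fin p → ℝ := fun i => if (i : ℕ) < q then d i ^ 2 else 0 with hsdef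
  have hs : Antitone s := by
    intro i j hij
    have hij' : (i : ℕ) ≤ j := hij
    simp only [hsdef]
    split_ifs with h1 h2 h2
    · exact pow_le_pow_left₀ (hd0 _) (hd hij') 2
    · omega
    · positivity
    · rfl
  -- the captured mass is a weighted sum of the squared singular values
  have hmass : ∀ X : Matrix (Fin p) (Fin r) ℝ,
      frobNorm (Xᵀ * A) ^ 2 = ∑ i, s i * ∑ a, (Xᵀ * U) a i ^ 2 := fun X => by
    have e1 : Xᵀ * A = ((Xᵀ * U) * D) * Vᵀ := by rw [hA]; simp only [Matrix.mul_assoc]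
    have e2 : D * Dᵀ = Matrix.diagonal s := by
      ext i i'
      simp only [hD, hsdef, Matrix.mul_apply, Matrix.transpose_apply, Matrix.of_apply,
        Matrix.diagonal_apply]
      by_cases hi : (i : ℕ) < q
      · rw [Finset.sum_eq_single ⟨i, hi⟩]
        · by_cases hii : i = i'
          · subst hii; simp [hi, sq]
          · have : (i' : ℕ) ≠ i := fun h => hii (Fin.ext h.symm)
            simp [hii, this]
        · intro j _ hj
          have : (i : ℕ) ≠ j := fun h => hj (Fin.ext h.symm)
          simp [this]
        · simp
      · rw [Finset.sum_eq_zero]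
        · simp [hi]
        · intro j _
          have : (i : ℕ) ≠ j := fun h => hi (h ▸ j.2)
          simp [this]
    rw [e1, frobNorm_mul_orthonormal_transpose hV', ← frobNorm_transpose, frobNorm_sq_eq_trace,
      Matrix.transpose_transpose, Matrix.transpose_mul, Matrix.mul_assoc, ← Matrix.mul_assoc D, e2,
      Matrix.trace]
    simp only [Matrix.diag]
    rw [Finset.sum_congr rfl fun i _ => Finset.mul_sum _ _ _, Finset.sum_comm]
    refine Finset.sum_congr rfl fun a _ => ?_
    rw [Matrix.mul_apply]
    refine Finset.sum_congr rfl fun i _ => ?_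
    rw [Matrix.diagonal_mul, Matrix.transpose_apply]
    ring
  have hcol : ∀ (X : Matrix (Fin p) (Fin r) ℝ), Xᵀ * X = 1 → ∀ i, ∑ a, (Xᵀ * U) a i ^ 2 ≤ 1 := by
    intro X hX i
    have e3 : ∑ a, (Xᵀ * U) a i ^ 2
        = frobNorm (Xᵀ * Matrix.replicateCol (Fin 1) (fun k => U k i)) ^ 2 := by
      rw [frobNorm_sq]
      simp [Matrix.mul_apply]
    have e4 : frobNorm (Matrix.replicateCol (Fin 1) (fun k => U k i)) ^ 2 = 1 := by
      rw [frobNorm_sq]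
      have := congrFun (congrFun hU' i) i
      simpa [Matrix.mul_apply, sq] using this
    rw [e3, ← e4, frobNorm_sq_eq_add hX (Matrix.replicateCol (Fin 1) _)]
    nlinarith [sq_nonneg (frobNorm ((1 - X * Xᵀ) * Matrix.replicateCol (Fin 1) fun k => U k i))]
  have htot : ∀ (X : Matrix (Fin p) (Fin r) ℝ), Xᵀ * X = 1 →
      ∑ i, ∑ a, (Xᵀ * U) a i ^ 2 = r := by
    intro X hX
    have hUt : (Uᵀ)ᵀ * Uᵀ = 1 := by rw [Matrix.transpose_transpose, hU'']
    rw [← frobNorm_sq_eq_sum_col, ← frobNorm_transpose, Matrix.transpose_mul,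
      Matrix.transpose_transpose, frobNorm_orthonormal_mul hUt, frobNorm_sq_orthonormal hX]
  have htop : ∀ i, ∑ a, (Wᵀ * U) a i ^ 2 = if (i : ℕ) < r then 1 else 0 := by
    intro i
    have e5 : ∀ a, (Wᵀ * U) a i = if Fin.castLE hrp a = i then 1 else 0 := fun a => by
      have := congrFun (congrFun hU' (Fin.castLE hrp a)) i
      rw [Matrix.one_apply] at this
      rw [← this, hWU]
      simp [Matrix.mul_apply]
    simp only [e5]
    by_cases hi : (i : ℕ) < r
    · rw [Finset.sum_eq_single ⟨i, hi⟩]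
      · simp [hi]
      · intro a _ ha
        have : Fin.castLE hrp a ≠ i := fun h => ha (Fin.ext (by simpa using congrArg Fin.val h))
        simp [this]
      · simp
    · rw [Finset.sum_eq_zero]
      · simp [hi]
      · intro a _
        have : Fin.castLE hrp a ≠ i := fun h => hi (by rw [← h]; exact a.2)
        simp [this]
  rw [hmass, hmass]
  simp only [htop]
  exact sum_mul_le_sum_filter_lt hs (fun i => by positivity) (hcol Q hQ) hrp (htot Q hQ)

/-- Sine theorem for left singular spaces: let `A₀ = Q G` with `Q` orthonormal and all `r` singular
values of `G` at least `g`. Then the top left singular vectors `W` of `A` satisfy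
`‖(1 - W Wᵀ) Q‖_F ≤ 2 ‖A - A₀‖_F / g`. The projection `1 - W Wᵀ` is small on `A` by Ky Fan's
principle, since `1 - Q Qᵀ` maps `A` and `A - A₀` to the same matrix. -/
theorem IsTopLeftSingularVectors.sin_le {A : Matrix (Fin p) (Fin q) ℝ}
    {W Q : Matrix (Fin p) (Fin r) ℝ} (h : IsTopLeftSingularVectors A W) (hQ : Qᵀ * Q = 1)
    {G : Matrix (Fin r) (Fin q) ℝ} {g : ℝ} (hg : 0 ≤ g)
    (hG : ∀ v, g ^ 2 * (v ⬝ᵥ v) ≤ (v ᵥ* G) ⬝ᵥ (v ᵥ* G)) :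
    g * frobNorm ((1 - W * Wᵀ) * Q) ≤ 2 * frobNorm (A - Q * G) := by
  have hW := h.orthonormal
  have h1 : frobNorm ((1 - W * Wᵀ) * A) ≤ frobNorm (A - Q * G) := by
    have h2 := h.frobNorm_transpose_mul_le hQ
    have h3 := frobNorm_sq_eq_add hW A
    have h4 := frobNorm_sq_eq_add hQ A
    have h5 : (1 - Q * Qᵀ) * A = (1 - Q * Qᵀ) * (A - Q * G) := by
      have : (1 - Q * Qᵀ) * (Q * G) = 0 := by
        rw [Matrix.sub_mul, Matrix.one_mul, Matrix.mul_assoc, ← Matrix.mul_assoc Qᵀ, hQ,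
          Matrix.one_mul, sub_self]
      rw [Matrix.mul_sub, this, sub_zero]
    have h6 := frobNorm_proj_compl_mul_le hQ (A - Q * G)
    rw [← h5] at h6
    refine le_trans ?_ h6
    exact (sq_le_sq₀ (frobNorm_nonneg _) (frobNorm_nonneg _)).1 (by linarith)
  have h7 := mul_frobNorm_le hg hG ((1 - W * Wᵀ) * Q)
  have h8 : (1 - W * Wᵀ) * Q * G = (1 - W * Wᵀ) * A - (1 - W * Wᵀ) * (A - Q * G) := by
    rw [Matrix.mul_sub, sub_sub_cancel, Matrix.mul_assoc]
  have h9 := frobNorm_sub_le ((1 - W * Wᵀ) * A) ((1 - W * Wᵀ) * (A - Q * G))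
  have h10 := frobNorm_proj_compl_mul_le hW (A - Q * G)
  rw [h8] at h7
  linarith

/-- Triangle inequality for sine distances: the column-space distance between two orthonormal systems is controlled by their sine distances
to a third one of the same size. -/
theorem columnDist_le_of_sin (hr : 0 < r) {W₁ W₂ Q : Matrix (Fin p) (Fin r) ℝ}
    (h₁ : W₁ᵀ * W₁ = 1) (h₂ : W₂ᵀ * W₂ = 1) (hQ : Qᵀ * Q = 1) :
    columnDist W₁ W₂ ≤
      2 * √r * (frobNorm ((1 - W₁ * W₁ᵀ) * Q) + frobNorm ((1 - W₂ * W₂ᵀ) * Q)) := by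
  refine (columnDist_le_mul_sin hr h₁ h₂).trans ?_
  gcongr
  have e : (1 - W₂ * W₂ᵀ) * W₁ = (1 - W₂ * W₂ᵀ) * ((1 - Q * Qᵀ) * W₁)
      + (1 - W₂ * W₂ᵀ) * (Q * (Qᵀ * W₁)) := by
    rw [← Matrix.mul_add, Matrix.sub_mul 1 (Q * Qᵀ), Matrix.one_mul, Matrix.mul_assoc Q,
      sub_add_cancel]
  -- the sine distance is symmetric
  have hsym : frobNorm ((1 - Q * Qᵀ) * W₁) = frobNorm ((1 - W₁ * W₁ᵀ) * Q) := by
    refine (sq_eq_sq₀ (frobNorm_nonneg _) (frobNorm_nonneg _)).1 ?_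
    have h3 := frobNorm_sq_eq_add hQ W₁
    have h4 := frobNorm_sq_eq_add h₁ Q
    rw [frobNorm_sq_orthonormal h₁] at h3
    rw [frobNorm_sq_orthonormal hQ, ← frobNorm_transpose, Matrix.transpose_mul,
      Matrix.transpose_transpose] at h4
    linarith
  have h5 : frobNorm ((1 - W₂ * W₂ᵀ) * (Q * (Qᵀ * W₁))) ≤ frobNorm ((1 - W₂ * W₂ᵀ) * Q) := by
    have h6 : ∀ X : Matrix (Fin p) (Fin r) ℝ, frobNorm (X * (Qᵀ * W₁)) ≤ frobNorm X := fun X => by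
      have h7 := frobNorm_mul_orthonormal_transpose hQ X
      have h8 := frobNorm_sq_eq_add h₁ (X * Qᵀ)ᵀ
      rw [frobNorm_transpose, h7, ← frobNorm_transpose (W₁ᵀ * _), Matrix.transpose_mul,
        Matrix.transpose_transpose, Matrix.transpose_transpose, Matrix.mul_assoc] at h8
      exact (sq_le_sq₀ (frobNorm_nonneg _) (frobNorm_nonneg _)).1 (by
        nlinarith [sq_nonneg (frobNorm ((1 - W₁ * W₁ᵀ) * (X * Qᵀ)ᵀ))])
    rw [← Matrix.mul_assoc]
    exact h6 _
  have h9 := frobNorm_proj_compl_mul_le h₂ ((1 - Q * Qᵀ) * W₁)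
  rw [e]
  refine (frobNorm_add_le _ _).trans ?_
  rw [hsym] at h9
  linarith

/-- Two matrices close to the rank-`r` matrix `B M` have close top left singular spaces. Writing
`B = Q R` for the polar decomposition, the sine theorem applies with `G = R M`, whose singular
values are at least `b g`. -/
theorem columnDist_le_of_isTopLeftSingularVectors (hr : 0 < r)
    {A₁ A₂ : Matrix (Fin p) (Fin q) ℝ} {W₁ W₂ : Matrix (Fin p) (Fin r) ℝ}
    (h₁ : IsTopLeftSingularVectors A₁ W₁) (h₂ : IsTopLeftSingularVectors A₂ W₂)
    {B : Matrix (Fin p) (Fin r) ℝ} {M : Matrix (Fin r) (Fin q) ℝ} {b g : ℝ} (hb : 0 < b)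
    (hg : 0 < g) (hB : ∀ v, b ^ 2 * (v ⬝ᵥ v) ≤ (B *ᵥ v) ⬝ᵥ (B *ᵥ v))
    (hM : ∀ v, g ^ 2 * (v ⬝ᵥ v) ≤ (v ᵥ* M) ⬝ᵥ (v ᵥ* M)) :
    columnDist W₁ W₂ ≤
      4 * √r / (b * g) * (frobNorm (A₁ - B * M) + frobNorm (A₂ - B * M)) := by
  obtain ⟨Q, R, hQ, hBQ, hRp, hRR⟩ := exists_polar B (pow_pos hb 2) hB
  have hRt : Rᵀ = R := by simpa using hRp.isHermitian.eq
  have hG : ∀ v, (b * g) ^ 2 * (v ⬝ᵥ v) ≤ (v ᵥ* (R * M)) ⬝ᵥ (v ᵥ* (R * M)) := fun v => by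
    rw [← Matrix.vecMul_vecMul]
    refine le_trans ?_ (hM (v ᵥ* R))
    rw [← Matrix.mulVec_transpose, hRt, dotProduct_mulVec_self, hRt, hRR, ← dotProduct_mulVec_self]
    have := mul_le_mul_of_nonneg_left (hB v) (sq_nonneg g)
    linarith
  have e : B * M = Q * (R * M) := by rw [hBQ, Matrix.mul_assoc]
  have hbg : 0 < b * g := mul_pos hb hg
  have s₁ := h₁.sin_le hQ hbg.le hG
  have s₂ := h₂.sin_le hQ hbg.le hG
  rw [← e] at s₁ s₂
  refine (columnDist_le_of_sin hr h₁.orthonormal h₂.orthonormal hQ).trans ?_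
  have e2 : 4 * √r / (b * g) * (frobNorm (A₁ - B * M) + frobNorm (A₂ - B * M))
      = 2 * √r * (2 * frobNorm (A₁ - B * M) / (b * g) + 2 * frobNorm (A₂ - B * M) / (b * g)) := by
    field_simp
    ring
  rw [e2]
  gcongr
  · rw [le_div_iff₀ hbg]; linarith
  · rw [le_div_iff₀ hbg]; linarith

end SingularVectors

/-! ### Singular values as lower bounds -/

section SingularValues

open Module

variable {E F : Type*} [NormedAddCommGroup E] [InnerProductSpace ℝ E] [FiniteDimensional ℝ E]
  [NormedAddCommGroup F] [InnerProductSpace ℝ F] [FiniteDimensional ℝ F]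

/-- The images of the right singular vectors are orthogonal, with norms the singular values. -/
theorem LinearMap.inner_map_eigenvectorBasis (T : E →ₗ[ℝ] F) (i : Fin (finrank ℝ E)) (v : E) :
    inner ℝ (T (T.isSymmetric_adjoint_comp_self.eigenvectorBasis rfl i)) (T v)
      = T.singularValues i ^ 2
        * inner ℝ (T.isSymmetric_adjoint_comp_self.eigenvectorBasis rfl i) v := by
  rw [T.sq_singularValues_fin rfl, ← LinearMap.adjoint_inner_left, ← LinearMap.comp_apply,
    LinearMap.IsSymmetric.apply_eigenvectorBasis]
  simp [inner_smul_left]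

/-- `T` is bounded below, by its `(k+1)`-th singular value, on the span of its first `k + 1` right
singular vectors. -/
theorem LinearMap.singularValues_mul_le (T : E →ₗ[ℝ] F) {k : ℕ} (c : E)
    (hc : ∀ i : Fin (finrank ℝ E), k < i →
      inner ℝ (T.isSymmetric_adjoint_comp_self.eigenvectorBasis rfl i) c = 0) :
    T.singularValues k ^ 2 * ‖c‖ ^ 2 ≤ ‖T c‖ ^ 2 := by
  set b := T.isSymmetric_adjoint_comp_self.eigenvectorBasis rfl with hb
  have h1 : ‖T c‖ ^ 2 = ∑ i : Fin (finrank ℝ E), T.singularValues i ^ 2 * inner ℝ (b i) c ^ 2 := by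
    rw [← real_inner_self_eq_norm_sq]
    conv_lhs => enter [2]; rw [← b.sum_repr' c]
    rw [map_sum, sum_inner]
    refine Finset.sum_congr rfl fun i _ => ?_
    rw [map_smul, inner_smul_left, hb, T.inner_map_eigenvectorBasis]
    simp only [RCLike.conj_to_real]
    ring
  have h2 : ‖c‖ ^ 2 = ∑ i, inner ℝ (b i) c ^ 2 := (b.sum_sq_inner_right c).symm
  rw [h1, h2, Finset.mul_sum]
  refine Finset.sum_le_sum fun i _ => ?_
  rcases le_or_gt (i : ℕ) k with h | h
  · gcongr
    · exact T.singularValues_nonneg _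
    · exact T.singularValues_antitone h
  · simp [hc i h]

/-- A map with full row rank: its last singular value bounds the adjoint from below. -/
theorem LinearMap.singularValues_mul_le_adjoint (T : E →ₗ[ℝ] F) {r : ℕ} (hr : 0 < r)
    (hF : finrank ℝ F = r) {g : ℝ} (hg : 0 < g) (h : g ≤ T.singularValues (r - 1)) (v : F) :
    g ^ 2 * ‖v‖ ^ 2 ≤ ‖T.adjoint v‖ ^ 2 := by
  have hrE : r ≤ finrank ℝ E := by
    by_contra! hlt
    have := T.singularValues_of_finrank_le (i := r - 1) (by omega)
    linarith
  set b := T.isSymmetric_adjoint_comp_self.eigenvectorBasis rfl with hb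
  -- the span of the first `r` right singular vectors is mapped bijectively
  set J : EuclideanSpace ℝ (Fin r) →ₗ[ℝ] E :=
    { toFun := fun c => ∑ i : Fin r, c i • b (Fin.castLE hrE i)
      map_add' := fun c c' => by simp [add_smul, Finset.sum_add_distrib]
      map_smul' := fun a c => by simp [mul_smul, Finset.smul_sum] } with hJ
  have hJin : ∀ c (i : Fin (finrank ℝ E)), r - 1 < i → inner ℝ (b i) (J c) = 0 := by
    intro c i hi
    simp only [hJ, LinearMap.coe_mk, AddHom.coe_mk, inner_sum, inner_smul_right]
    refine Finset.sum_eq_zero fun a _ => ?_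
    have : i ≠ Fin.castLE hrE a := fun h => by
      have := congrArg Fin.val h
      simp at this
      omega
    rw [b.inner_eq_zero this, mul_zero]
  have hJinj : ∀ c, J c = 0 → c = 0 := by
    intro c hc
    ext a
    have h3 : inner ℝ (b (Fin.castLE hrE a)) (J c) = c a := by
      simp only [hJ, LinearMap.coe_mk, AddHom.coe_mk, inner_sum, inner_smul_right]
      rw [Finset.sum_eq_single a]
      · simp
      · intro a' _ ha'
        rw [b.inner_eq_zero (fun h => ha' (by simpa using h.symm)), mul_zero]
      · simp
    rw [← h3, hc]
    simp
  have hlow : ∀ c, g ^ 2 * ‖J c‖ ^ 2 ≤ ‖T (J c)‖ ^ 2 := fun c => by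
    refine le_trans ?_ (T.singularValues_mul_le (k := r - 1) (J c) fun i hi => hJin c i hi)
    gcongr
  have hinj : Function.Injective (T ∘ₗ J) := by
    refine (injective_iff_map_eq_zero _).2 fun c hc => hJinj c ?_
    have h4 := hlow c
    rw [LinearMap.comp_apply] at hc
    rw [hc, norm_zero] at h4
    have h5 : ‖J c‖ ^ 2 ≤ 0 := by
      have := pow_pos hg 2
      nlinarith [sq_nonneg ‖J c‖]
    exact norm_eq_zero.1 (pow_eq_zero_iff two_ne_zero |>.1 (le_antisymm h5 (sq_nonneg _)))
  obtain ⟨c, hc⟩ := (LinearMap.injective_iff_surjective_of_finrank_eq_finrank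
    (by rw [hF]; simp)).1 hinj v
  rw [LinearMap.comp_apply] at hc
  have h6 : ‖v‖ ^ 2 ≤ ‖T.adjoint v‖ * ‖J c‖ := by
    rw [← real_inner_self_eq_norm_sq]
    conv_lhs => enter [3]; rw [← hc]
    rw [← LinearMap.adjoint_inner_left]
    exact real_inner_le_norm _ _
  have h7 := hlow c
  rw [hc] at h7
  have h8 : g * ‖J c‖ ≤ ‖v‖ := by
    refine (sq_le_sq₀ (by positivity) (norm_nonneg _)).1 ?_
    rw [mul_pow]; exact h7
  have h9 : g * ‖v‖ ≤ ‖T.adjoint v‖ := by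
    rcases (norm_nonneg v).eq_or_lt with h0 | h0
    · rw [← h0, mul_zero]; exact norm_nonneg _
    · refine le_of_mul_le_mul_right ?_ h0
      calc g * ‖v‖ * ‖v‖ = g * ‖v‖ ^ 2 := by ring
        _ ≤ g * (‖T.adjoint v‖ * ‖J c‖) := by gcongr
        _ = ‖T.adjoint v‖ * (g * ‖J c‖) := by ring
        _ ≤ ‖T.adjoint v‖ * ‖v‖ := by gcongr
  rw [← mul_pow]
  gcongr

theorem dotProduct_self_eq_norm_sq {n : ℕ} (v : EuclideanSpace ℝ (Fin n)) :
    v.ofLp ⬝ᵥ v.ofLp = ‖v‖ ^ 2 := by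
  rw [EuclideanSpace.real_norm_sq_eq]
  simp [dotProduct, sq]

/-- The last singular value of a matrix with `r` columns bounds its action from below. -/
theorem singularValue_mul_le_mulVec {p r : ℕ} (B : Matrix (Fin p) (Fin r) ℝ) {b : ℝ} (hb : 0 ≤ b)
    (h : b ≤ singularValue B r) (v : Fin r → ℝ) :
    b ^ 2 * (v ⬝ᵥ v) ≤ (B *ᵥ v) ⬝ᵥ (B *ᵥ v) := by
  have h1 := B.toEuclideanLin.singularValues_mul_le (k := r - 1) (WithLp.toLp 2 v) fun i hi => by
    have := i.2
    simp only [finrank_euclideanSpace, Fintype.card_fin] at this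
    omega
  rw [← dotProduct_self_eq_norm_sq, ← dotProduct_self_eq_norm_sq] at h1
  refine le_trans ?_ h1
  have := dotProduct_self_nonneg' v
  simp only
  gcongr
  exact h

/-- The `r`-th singular value of a matrix with `r` rows bounds the action of its transpose from
below. -/
theorem singularValue_mul_le_vecMul {r q : ℕ} (M : Matrix (Fin r) (Fin q) ℝ) (hr : 0 < r) {g : ℝ}
    (hg : 0 < g) (h : g ≤ singularValue M r) (v : Fin r → ℝ) :
    g ^ 2 * (v ⬝ᵥ v) ≤ (v ᵥ* M) ⬝ᵥ (v ᵥ* M) := by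
  have h1 := M.toEuclideanLin.singularValues_mul_le_adjoint hr (by simp) hg h (WithLp.toLp 2 v)
  rw [← Matrix.toEuclideanLin_conjTranspose_eq_adjoint, ← dotProduct_self_eq_norm_sq,
    ← dotProduct_self_eq_norm_sq] at h1
  simpa [Matrix.mulVec_transpose] using h1

end SingularValues

/-! ### Smallest eigenvalue of a Gaussian Gram matrix -/

section GaussianGram

variable {Ω : Type*} [MeasurableSpace Ω] {μ : Measure Ω} {n p : ℕ}

/-- Linear functionals of a standard Gaussian vector are Gaussian. -/
theorem hasLaw_inner_stdGaussian {w : Ω → EuclideanSpace ℝ (Fin p)}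
    (hw : HasLaw w (stdGaussian (EuclideanSpace ℝ (Fin p))) μ) (u : EuclideanSpace ℝ (Fin p)) :
    HasLaw (fun ω => inner ℝ u (w ω)) (gaussianReal 0 (‖u‖ ^ 2).toNNReal) μ := by
  have h1 : HasLaw (innerSL ℝ u) (gaussianReal 0 (‖u‖ ^ 2).toNNReal)
      (stdGaussian (EuclideanSpace ℝ (Fin p))) := by
    refine ⟨by fun_prop, ?_⟩
    rw [IsGaussian.map_eq_gaussianReal, integral_strongDual_stdGaussian,
      variance_dual_stdGaussian, innerSL_apply_norm]
  exact h1.fun_comp hw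

/-- The moment generating function of `g²`, `g` a centred Gaussian of variance `v`. -/
theorem mgf_sq_gaussianReal (v : NNReal) {a : ℝ} (ha : 2 * a * v < 1) :
    mgf (fun t : ℝ => t ^ 2) (gaussianReal 0 v) a = (√(1 - 2 * a * v))⁻¹ := by
  rcases eq_or_ne v 0 with rfl | hv
  · simp [mgf, gaussianReal_zero_var]
  have hv0 : (0 : ℝ) < v := by positivity
  have hb : 0 < 1 / (2 * (v : ℝ)) - a := by
    rw [sub_pos, lt_div_iff₀ (by positivity)]; linarith
  rw [mgf, integral_gaussianReal_eq_integral_smul hv]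
  have e : ∀ x : ℝ, gaussianPDFReal 0 v x • Real.exp (a * x ^ 2)
      = (√(2 * Real.pi * v))⁻¹ * Real.exp (-(1 / (2 * (v : ℝ)) - a) * x ^ 2) := fun x => by
    rw [gaussianPDFReal, smul_eq_mul, mul_assoc, ← Real.exp_add]
    congr 2
    field_simp
    ring
  simp_rw [e]
  rw [integral_const_mul, integral_gaussian, ← Real.sqrt_inv, ← Real.sqrt_inv,
    ← Real.sqrt_mul (by positivity)]
  congr 1
  field_simp

variable {w : Fin n → Ω → EuclideanSpace ℝ (Fin p)}

theorem lintegral_exp_sum_inner_sq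
    (hw : ∀ i, HasLaw (w i) (stdGaussian (EuclideanSpace ℝ (Fin p))) μ) (hind : iIndepFun w μ)
    (u : EuclideanSpace ℝ (Fin p)) {a : ℝ} (ha : 2 * a * ‖u‖ ^ 2 < 1) :
    ∫⁻ ω, ENNReal.ofReal (Real.exp (a * ∑ i, inner ℝ u (w i ω) ^ 2)) ∂μ
      = ENNReal.ofReal ((√(1 - 2 * a * ‖u‖ ^ 2))⁻¹ ^ n) := by
  have hX : ∀ i, HasLaw (fun ω => inner ℝ u (w i ω)) (gaussianReal 0 (‖u‖ ^ 2).toNNReal) μ :=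
    fun i => hasLaw_inner_stdGaussian (hw i) u
  have hind' : iIndepFun (fun i ω => inner ℝ u (w i ω) ^ 2) μ :=
    hind.comp (fun _ x => inner ℝ u x ^ 2) fun _ => by fun_prop
  have hv : (((‖u‖ ^ 2).toNNReal : NNReal) : ℝ) = ‖u‖ ^ 2 := Real.coe_toNNReal _ (by positivity)
  have hmgf : ∀ i, mgf (fun ω => inner ℝ u (w i ω) ^ 2) μ a = (√(1 - 2 * a * ‖u‖ ^ 2))⁻¹ := by
    intro i
    have h1 := mgf_sq_gaussianReal (‖u‖ ^ 2).toNNReal (a := a) (by rw [hv]; exact ha)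
    rw [hv] at h1
    rw [← h1, mgf, mgf, ← (hX i).integral_comp (by fun_prop)]
    rfl
  have hsum := hind'.mgf_sum₀ (t := a) (fun i => by
    have := (hX i).aemeasurable
    fun_prop) Finset.univ
  rw [Finset.prod_congr rfl fun i _ => hmgf i, Finset.prod_const, Finset.card_univ,
    Fintype.card_fin, mgf] at hsum
  simp only [Finset.sum_apply] at hsum
  have hpos : 0 < (√(1 - 2 * a * ‖u‖ ^ 2))⁻¹ ^ n := by
    have : 0 < 1 - 2 * a * ‖u‖ ^ 2 := by linarith
    positivity
  -- a nonzero Bochner integral comes from an integrable function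
  have hint : Integrable (fun ω => Real.exp (a * ∑ i, inner ℝ u (w i ω) ^ 2)) μ := by
    by_contra hcon
    rw [integral_undef hcon] at hsum
    exact hpos.ne hsum
  rw [← hsum, ofReal_integral_eq_lintegral_ofReal hint (ae_of_all _ fun _ => (Real.exp_pos _).le)]

/-- Markov's inequality for `Z = ∫_s exp (a ∑ᵢ ⟨u, wᵢ⟩²) du`, a set `s` of directions on which the
Laplace transform is at most `κ`: an event on which `Z` is at least `η` times the volume of a ball of
radius `ρ` has probability at most `(2/ρ)ᵖ κ / η`. The event need not be measurable. -/
theorem measure_le_of_lintegral_exp [IsProbabilityMeasure μ]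
    (hw : ∀ i, HasLaw (w i) (stdGaussian (EuclideanSpace ℝ (Fin p))) μ) (hind : iIndepFun w μ)
    {s : Set (EuclideanSpace ℝ (Fin p))} (hs2 : s ⊆ Metric.ball 0 2)
    {a κ η ρ : ℝ} (hη : 0 < η) (hρ : 0 < ρ)
    (hκ : ∀ u ∈ s, 2 * a * ‖u‖ ^ 2 < 1 ∧ (√(1 - 2 * a * ‖u‖ ^ 2))⁻¹ ^ n ≤ κ)
    {T : Set Ω} (hT : ∀ ω ∈ T, ENNReal.ofReal η * volume (Metric.ball
      (0 : EuclideanSpace ℝ (Fin p)) ρ) ≤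
        ∫⁻ u in s, ENNReal.ofReal (Real.exp (a * ∑ i, inner ℝ u (w i ω) ^ 2))) :
    μ T ≤ ENNReal.ofReal ((2 / ρ) ^ p * κ / η) := by
  set Z : Ω → ℝ≥0∞ := fun ω =>
    ∫⁻ u in s, ENNReal.ofReal (Real.exp (a * ∑ i, inner ℝ u (w i ω) ^ 2)) with hZ
  have hmeas : AEMeasurable (Function.uncurry fun (ω : Ω) (u : EuclideanSpace ℝ (Fin p)) =>
      ENNReal.ofReal (Real.exp (a * ∑ i, inner ℝ u (w i ω) ^ 2)))
      (μ.prod (volume.restrict s)) := by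
    have h1 : ∀ i, AEMeasurable (fun z : Ω × EuclideanSpace ℝ (Fin p) => w i z.1)
        (μ.prod (volume.restrict s)) := fun i => (hw i).aemeasurable.comp_fst
    have h2 : ∀ i, AEMeasurable (fun z : Ω × EuclideanSpace ℝ (Fin p) => inner ℝ z.2 (w i z.1))
        (μ.prod (volume.restrict s)) := fun i => measurable_snd.aemeasurable.inner (h1 i)
    simp only [Function.uncurry_def]
    fun_prop
  have hZm : AEMeasurable Z μ := hmeas.lintegral_prod_right'
  have hb0 : volume (Metric.ball (0 : EuclideanSpace ℝ (Fin p)) 1) ≠ 0 :=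
    (Metric.measure_ball_pos _ _ one_pos).ne'
  have hbt : volume (Metric.ball (0 : EuclideanSpace ℝ (Fin p)) 1) ≠ ∞ := measure_ball_lt_top.ne
  have hball : ∀ t : ℝ, 0 < t → volume (Metric.ball (0 : EuclideanSpace ℝ (Fin p)) t)
      = ENNReal.ofReal (t ^ p) * volume (Metric.ball (0 : EuclideanSpace ℝ (Fin p)) 1) := by
    intro t ht
    rw [Measure.addHaar_ball_of_pos _ _ ht]
    simp
  have hEZ : ∫⁻ ω, Z ω ∂μ ≤ ENNReal.ofReal (κ * 2 ^ p)
      * volume (Metric.ball (0 : EuclideanSpace ℝ (Fin p)) 1) := by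
    rw [hZ, lintegral_lintegral_swap hmeas]
    calc ∫⁻ u in s, ∫⁻ ω, ENNReal.ofReal (Real.exp (a * ∑ i, inner ℝ u (w i ω) ^ 2)) ∂μ
        ≤ ∫⁻ u in s, ENNReal.ofReal κ := by
          refine setLIntegral_mono measurable_const fun u hu => ?_
          rw [lintegral_exp_sum_inner_sq hw hind u (hκ u hu).1]
          exact ENNReal.ofReal_le_ofReal (hκ u hu).2
      _ = ENNReal.ofReal κ * volume s := setLIntegral_const _ _
      _ ≤ ENNReal.ofReal κ * volume (Metric.ball (0 : EuclideanSpace ℝ (Fin p)) 2) := by gcongr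
      _ = _ := by
          rw [hball 2 two_pos, ← mul_assoc, ENNReal.ofReal_mul' (by positivity)]
  have hmark := mul_meas_ge_le_lintegral₀ hZm
    (ENNReal.ofReal η * volume (Metric.ball (0 : EuclideanSpace ℝ (Fin p)) ρ))
  have h3 : ENNReal.ofReal η * volume (Metric.ball (0 : EuclideanSpace ℝ (Fin p)) ρ) * μ T
      ≤ ENNReal.ofReal (κ * 2 ^ p) * volume (Metric.ball (0 : EuclideanSpace ℝ (Fin p)) 1) :=
    (mul_le_mul_right (measure_mono (fun ω hω => hT ω hω)) _).trans (hmark.trans hEZ)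
  rw [hball ρ hρ, ← mul_assoc, mul_right_comm, ENNReal.mul_le_mul_iff_left hb0 hbt,
    ← ENNReal.ofReal_mul hη.le] at h3
  have hηρ : 0 < η * ρ ^ p := by positivity
  have e : (2 / ρ) ^ p * κ / η = κ * 2 ^ p / (η * ρ ^ p) := by
    rw [div_pow]
    field_simp
  rw [e, ENNReal.ofReal_div_of_pos hηρ]
  rw [ENNReal.le_div_iff_mul_le (Or.inl (by simpa using hηρ)) (Or.inl ENNReal.ofReal_ne_top),
    mul_comm]
  exact h3

theorem sum_inner_add_sq (x : Fin n → EuclideanSpace ℝ (Fin p)) (u v : EuclideanSpace ℝ (Fin p)) :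
    ∑ i, inner ℝ (u + v) (x i) ^ 2 ≤ 2 * ∑ i, inner ℝ u (x i) ^ 2 + 2 * ∑ i, inner ℝ v (x i) ^ 2 := by
  rw [Finset.mul_sum, Finset.mul_sum, ← Finset.sum_add_distrib]
  refine Finset.sum_le_sum fun i _ => ?_
  rw [inner_add_left]
  nlinarith [sq_nonneg (inner ℝ u (x i) - inner ℝ v (x i))]

/-- Upper tail of the largest eigenvalue. By convexity the average of `exp (∑ ⟨u, wᵢ⟩² / 16)` over
the unit ball around a bad direction is at least its value at the centre. -/
theorem measure_exists_lt_sum_inner_sq_le [IsProbabilityMeasure μ]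
    (hw : ∀ i, HasLaw (w i) (stdGaussian (EuclideanSpace ℝ (Fin p))) μ) (hind : iIndepFun w μ)
    (hpn : p ≤ n) :
    μ {ω | ∃ u, ‖u‖ = 1 ∧ 32 * n < ∑ i, inner ℝ u (w i ω) ^ 2}
      ≤ ENNReal.ofReal (Real.exp (-(n / 8))) := by
  have h2 : (0 : ℝ) < √2 := by positivity
  have key := measure_le_of_lintegral_exp (μ := μ) hw hind (s := Metric.ball 0 2)
    subset_rfl (a := 1 / 16) (κ := √2 ^ n)
    (η := Real.exp (2 * n)) (ρ := 1) (Real.exp_pos _) one_pos (fun u hu => by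
      have hu' : ‖u‖ < 2 := by simpa using hu
      have hu2 : ‖u‖ ^ 2 < 4 := by nlinarith [norm_nonneg u]
      refine ⟨by linarith, ?_⟩
      gcongr
      rw [← Real.sqrt_inv]
      refine Real.sqrt_le_sqrt ?_
      rw [inv_le_comm₀ (by linarith) two_pos]
      linarith)
    (T := {ω | ∃ u, ‖u‖ = 1 ∧ 32 * n < ∑ i, inner ℝ u (w i ω) ^ 2}) (by
      rintro ω ⟨v, hv, hvq⟩
      set F : EuclideanSpace ℝ (Fin p) → ℝ≥0∞ := fun u =>
        ENNReal.ofReal (Real.exp (1 / 16 * ∑ i, inner ℝ u (w i ω) ^ 2)) with hF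
      have hFm : Measurable F := by fun_prop
      have hmp : MeasurePreserving (fun u : EuclideanSpace ℝ (Fin p) => (2 : ℝ) • v - u)
          volume volume :=
        Measure.measurePreserving_sub_left volume _
      have hpre : (fun u : EuclideanSpace ℝ (Fin p) => (2 : ℝ) • v - u) ⁻¹' Metric.ball v 1
          = Metric.ball v 1 := by
        ext u
        have : (2 : ℝ) • v - u - v = -(u - v) := by module
        simp only [Set.mem_preimage, Metric.mem_ball, dist_eq_norm, this, norm_neg]
      have hrefl : ∫⁻ u in Metric.ball v 1, F ((2 : ℝ) • v - u) = ∫⁻ u in Metric.ball v 1, F u := by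
        have := hmp.setLIntegral_comp_preimage (s := Metric.ball v 1)
          Metric.isOpen_ball.measurableSet hFm
        rwa [hpre] at this
      -- averaging over the reflection `u ↦ 2v - u` of the ball
      have hpt : ∀ u, 2 * ENNReal.ofReal (Real.exp (2 * n)) ≤ F u + F ((2 : ℝ) • v - u) := by
        intro u
        set A := 1 / 16 * ∑ i, inner ℝ u (w i ω) ^ 2 with hA
        set B := 1 / 16 * ∑ i, inner ℝ ((2 : ℝ) • v - u) (w i ω) ^ 2 with hB
        have hsum := sum_inner_add_sq (fun i => w i ω) u ((2 : ℝ) • v - u)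
        have e1 : ∑ i, inner ℝ (u + ((2 : ℝ) • v - u)) (w i ω) ^ 2
            = 4 * ∑ i, inner ℝ v (w i ω) ^ 2 := by
          rw [add_sub_cancel, Finset.mul_sum]
          refine Finset.sum_congr rfl fun i _ => ?_
          rw [inner_smul_left]
          simp
          ring
        rw [e1] at hsum
        have hAB : 4 * (n : ℝ) ≤ A + B := by
          rw [hA, hB]; linarith
        have hexp : 2 * Real.exp (2 * n) ≤ Real.exp A + Real.exp B := by
          have t1 := Real.add_one_le_exp (A - 2 * n)
          have t2 := Real.add_one_le_exp (B - 2 * n)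
          have t3 : Real.exp A = Real.exp (2 * n) * Real.exp (A - 2 * n) := by
            rw [← Real.exp_add]; ring_nf
          have t4 : Real.exp B = Real.exp (2 * n) * Real.exp (B - 2 * n) := by
            rw [← Real.exp_add]; ring_nf
          rw [t3, t4]
          nlinarith [Real.exp_pos (2 * (n : ℝ))]
        have e2 : (2 : ℝ≥0∞) * ENNReal.ofReal (Real.exp (2 * n))
            = ENNReal.ofReal (2 * Real.exp (2 * n)) := by
          rw [ENNReal.ofReal_mul zero_le_two, ENNReal.ofReal_ofNat]
        rw [e2, hF]
        simp only
        rw [← ENNReal.ofReal_add (Real.exp_pos _).le (Real.exp_pos _).le]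
        exact ENNReal.ofReal_le_ofReal hexp
      have hball : volume (Metric.ball v 1) = volume (Metric.ball (0 : EuclideanSpace ℝ (Fin p)) 1) :=
        by rw [Measure.addHaar_ball_center]
      have h5 : 2 * (ENNReal.ofReal (Real.exp (2 * n)) * volume (Metric.ball v 1))
          ≤ 2 * ∫⁻ u in Metric.ball v 1, F u := by
        calc 2 * (ENNReal.ofReal (Real.exp (2 * n)) * volume (Metric.ball v 1))
            = ∫⁻ u in Metric.ball v 1, 2 * ENNReal.ofReal (Real.exp (2 * n)) := by
              rw [setLIntegral_const, mul_assoc]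
          _ ≤ ∫⁻ u in Metric.ball v 1, (F u + F ((2 : ℝ) • v - u)) :=
              lintegral_mono fun u => hpt u
          _ = 2 * ∫⁻ u in Metric.ball v 1, F u := by
              rw [lintegral_add_left hFm, hrefl, two_mul]
      rw [ENNReal.mul_le_mul_iff_right two_ne_zero ENNReal.ofNat_ne_top, hball] at h5
      refine h5.trans (lintegral_mono_set fun u hu => ?_)
      have : dist u v < 1 := hu
      have h6 := norm_sub_norm_le u v
      rw [← dist_eq_norm, hv] at h6
      simp only [Metric.mem_ball, dist_zero_right]
      linarith)
  refine key.trans (ENNReal.ofReal_le_ofReal ?_)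
  have s1 : (2 : ℝ) ^ p ≤ 2 ^ n := pow_le_pow_right₀ one_le_two hpn
  have s2 : (2 : ℝ) * √2 ≤ Real.exp (15 / 8) := by
    have t1 : √2 ≤ 1.42 := Real.sqrt_le_iff.2 ⟨by norm_num, by norm_num⟩
    have t2 := Real.add_one_le_exp (15 / 8 : ℝ)
    linarith
  rw [div_one, div_le_iff₀ (Real.exp_pos _), ← Real.exp_add]
  calc (2 : ℝ) ^ p * √2 ^ n ≤ 2 ^ n * √2 ^ n := by gcongr
    _ = (2 * √2) ^ n := (mul_pow _ _ _).symm
    _ ≤ Real.exp (15 / 8) ^ n := by gcongr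
    _ = Real.exp (-(n / 8) + 2 * n) := by
        rw [← Real.exp_nat_mul]; congr 1; ring

/-- Lower tail of the smallest eigenvalue, on the event that the largest one is bounded: then
`∑ ⟨u, wᵢ⟩²` remains small on a ball of radius `1/64` around a bad direction. -/
theorem measure_exists_sum_inner_sq_lt_aux [IsProbabilityMeasure μ]
    (hw : ∀ i, HasLaw (w i) (stdGaussian (EuclideanSpace ℝ (Fin p))) μ) (hind : iIndepFun w μ)
    (hpn : 50 * p ≤ n) :
    μ {ω | (∃ u, ‖u‖ = 1 ∧ ∑ i, inner ℝ u (w i ω) ^ 2 < 1 / 80 * n) ∧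
        ∀ u, ‖u‖ = 1 → ∑ i, inner ℝ u (w i ω) ^ 2 ≤ 32 * n}
      ≤ ENNReal.ofReal (Real.exp (-(n / 8))) := by
  have h2 : (0 : ℝ) < √2 := by positivity
  have key := measure_le_of_lintegral_exp (μ := μ) hw hind
    (s := Metric.ball 0 2 ∩ {u | 1 / 2 ≤ ‖u‖})
    Set.inter_subset_left (a := -2) (κ := (√2)⁻¹ ^ n)
    (η := Real.exp (-(13 / 160 * n))) (ρ := 1 / 64) (Real.exp_pos _) (by norm_num) (fun u hu => by
      have hu' : 1 / 2 ≤ ‖u‖ := hu.2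
      have hu2 : 1 / 4 ≤ ‖u‖ ^ 2 := by nlinarith [norm_nonneg u]
      refine ⟨by linarith, ?_⟩
      gcongr
      linarith)
    (T := {ω | (∃ u, ‖u‖ = 1 ∧ ∑ i, inner ℝ u (w i ω) ^ 2 < 1 / 80 * n) ∧
        ∀ u, ‖u‖ = 1 → ∑ i, inner ℝ u (w i ω) ^ 2 ≤ 32 * n}) (by
      rintro ω ⟨⟨v, hv, hvq⟩, hup⟩
      have hup' : ∀ u, ∑ i, inner ℝ u (w i ω) ^ 2 ≤ 32 * n * ‖u‖ ^ 2 := by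
        intro u
        rcases eq_or_ne u 0 with rfl | hu
        · simp
        have h1 := hup (‖u‖⁻¹ • u) (by
          rw [norm_smul, norm_inv, norm_norm, inv_mul_cancel₀ (norm_ne_zero_iff.2 hu)])
        have e : ∑ i, inner ℝ (‖u‖⁻¹ • u) (w i ω) ^ 2
            = (‖u‖ ^ 2)⁻¹ * ∑ i, inner ℝ u (w i ω) ^ 2 := by
          rw [Finset.mul_sum]
          refine Finset.sum_congr rfl fun i _ => ?_
          rw [inner_smul_left]
          simp [mul_pow]
        have hpos : 0 < ‖u‖ ^ 2 := by positivity
        rwa [e, inv_mul_le_iff₀ hpos, mul_comm] at h1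
      have hball : volume (Metric.ball v (1 / 64))
          = volume (Metric.ball (0 : EuclideanSpace ℝ (Fin p)) (1 / 64)) := by
        rw [Measure.addHaar_ball_center]
      rw [← hball, ← setLIntegral_const]
      refine (setLIntegral_mono (by fun_prop) fun u hu => ?_).trans (lintegral_mono_set fun u hu => ?_)
      · refine ENNReal.ofReal_le_ofReal (Real.exp_le_exp.2 ?_)
        have h3 := sum_inner_add_sq (fun i => w i ω) v (u - v)
        rw [add_sub_cancel] at h3
        have h4 := hup' (u - v)
        have h5 : ‖u - v‖ ^ 2 ≤ (1 / 64) ^ 2 := by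
          have : dist u v < 1 / 64 := hu
          rw [dist_eq_norm] at this
          gcongr
        have hn : (0 : ℝ) ≤ n := Nat.cast_nonneg n
        have h6 : 32 * (n : ℝ) * ‖u - v‖ ^ 2 ≤ 32 * n * (1 / 64) ^ 2 := by gcongr
        linarith
      · have : dist u v < 1 / 64 := hu
        rw [dist_eq_norm] at this
        have h6 := norm_sub_norm_le u v
        have h7 := norm_sub_norm_le v u
        rw [norm_sub_rev] at h7
        rw [hv] at h6 h7
        refine ⟨?_, ?_⟩
        · simp only [Metric.mem_ball, dist_zero_right]
          linarith
        · simp only [Set.mem_ofPred_eq]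
          linarith)
  refine key.trans (ENNReal.ofReal_le_ofReal ?_)
  have s1 : (128 : ℝ) ≤ Real.exp 5 := by
    have t1 : (2.7 : ℝ) ≤ Real.exp 1 := by linarith [Real.exp_one_gt_d9]
    have t2 : Real.exp 5 = Real.exp 1 ^ 5 := by rw [← Real.exp_nat_mul]; norm_num
    rw [t2]
    calc (128 : ℝ) ≤ 2.7 ^ 5 := by norm_num
      _ ≤ Real.exp 1 ^ 5 := by gcongr
  have s2 : (√2)⁻¹ ≤ Real.exp (-(34 / 100)) := by
    rw [Real.exp_neg]
    gcongr
    refine Real.le_sqrt_of_sq_le ?_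
    rw [← Real.exp_nat_mul, ← Real.le_log_iff_exp_le two_pos]
    have := Real.log_two_gt_d9
    norm_num at this ⊢
    linarith
  have hpn' : 50 * (p : ℝ) ≤ n := by exact_mod_cast hpn
  have hn : (0 : ℝ) ≤ n := Nat.cast_nonneg n
  rw [div_le_iff₀ (Real.exp_pos _), ← Real.exp_add]
  calc ((2 : ℝ) / (1 / 64)) ^ p * (√2)⁻¹ ^ n
      ≤ Real.exp 5 ^ p * Real.exp (-(34 / 100)) ^ n := by
        gcongr
        linarith
    _ = Real.exp (5 * p - 34 / 100 * n) := by
        rw [← Real.exp_nat_mul, ← Real.exp_nat_mul, ← Real.exp_add]; congr 1; ring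
    _ ≤ _ := Real.exp_le_exp.2 (by linarith)

/-- The Gram matrix of `n ≥ 50 p` standard Gaussian vectors is well conditioned from below, up to
exponentially small probability. -/
theorem measure_exists_sum_inner_sq_lt [IsProbabilityMeasure μ]
    (hw : ∀ i, HasLaw (w i) (stdGaussian (EuclideanSpace ℝ (Fin p))) μ) (hind : iIndepFun w μ)
    (hpn : 50 * p ≤ n) :
    μ {ω | ∃ u, ∑ i, inner ℝ u (w i ω) ^ 2 < 1 / 80 * n * ‖u‖ ^ 2}
      ≤ ENNReal.ofReal (2 * Real.exp (-(n / 8))) := by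
  rw [two_mul, ENNReal.ofReal_add (Real.exp_pos _).le (Real.exp_pos _).le]
  refine (measure_mono ?_).trans ((measure_union_le _ _).trans (add_le_add
    (measure_exists_lt_sum_inner_sq_le hw hind (by omega))
    (measure_exists_sum_inner_sq_lt_aux hw hind hpn)))
  rintro ω ⟨u, hu⟩
  by_cases hup : ∃ u, ‖u‖ = 1 ∧ 32 * n < ∑ i, inner ℝ u (w i ω) ^ 2
  · exact Or.inl hup
  push Not at hup
  refine Or.inr ⟨⟨‖u‖⁻¹ • u, ?_, ?_⟩, hup⟩
  all_goals
    have hu0 : u ≠ 0 := by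
      rintro rfl
      simp at hu
  · rw [norm_smul, norm_inv, norm_norm, inv_mul_cancel₀ (norm_ne_zero_iff.2 hu0)]
  · have e : ∑ i, inner ℝ (‖u‖⁻¹ • u) (w i ω) ^ 2
        = (‖u‖ ^ 2)⁻¹ * ∑ i, inner ℝ u (w i ω) ^ 2 := by
      rw [Finset.mul_sum]
      refine Finset.sum_congr rfl fun i _ => ?_
      rw [inner_smul_left]
      simp [mul_pow]
    have hpos : 0 < ‖u‖ ^ 2 := by positivity
    rw [e, inv_mul_lt_iff₀ hpos]
    linarith

end GaussianGram

/-! ### Stein's identity -/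

section Stein

theorem integrable_gaussianReal_iff {v : NNReal} (hv : v ≠ 0) {g : ℝ → ℝ} :
    Integrable g (gaussianReal 0 v) ↔ Integrable (fun t => gaussianPDFReal 0 v t * g t) := by
  rw [gaussianReal_of_var_ne_zero _ hv, integrable_withDensity_iff_integrable_smul'
    (measurable_gaussianPDF _ _) (ae_of_all _ fun _ => gaussianPDF_lt_top)]
  simp [toReal_gaussianPDF]

/-- Stein's identity in dimension one. Only differentiability is needed, since `φ g` and its
derivative are integrable. -/
theorem integral_mul_self_eq_integral_deriv_gaussianReal {g g' : ℝ → ℝ}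
    (hg : ∀ t, HasDerivAt g (g' t) t) (h0 : Integrable g (gaussianReal 0 1))
    (h1 : Integrable (fun t => t * g t) (gaussianReal 0 1))
    (h2 : Integrable g' (gaussianReal 0 1)) :
    ∫ t, t * g t ∂(gaussianReal 0 1) = ∫ t, g' t ∂(gaussianReal 0 1) := by
  have hφ : ∀ t, HasDerivAt (gaussianPDFReal 0 1) (-(t * gaussianPDFReal 0 1 t)) t := by
    intro t
    have h3 : HasDerivAt (fun x : ℝ => -(x - 0) ^ 2 / (2 * ((1 : NNReal) : ℝ))) (-t) t := by
      have := (((hasDerivAt_id t).sub_const 0).pow 2).neg.div_const (2 * ((1 : NNReal) : ℝ))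
      refine this.congr_deriv ?_
      simp
      ring
    have h4 := h3.exp.const_mul (√(2 * Real.pi * ((1 : NNReal) : ℝ)))⁻¹
    rw [gaussianPDFReal_def]
    refine h4.congr_deriv ?_
    ring
  have hd : ∀ t, HasDerivAt (fun t => gaussianPDFReal 0 1 t * g t)
      (gaussianPDFReal 0 1 t * (g' t - t * g t)) t := fun t =>
    ((hφ t).mul (hg t)).congr_deriv (by ring)
  have hz := integral_eq_zero_of_hasDerivAt_of_integrable hd
    ((integrable_gaussianReal_iff one_ne_zero).1 (h2.sub h1))
    ((integrable_gaussianReal_iff one_ne_zero).1 h0)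
  have h5 := integral_gaussianReal_eq_integral_smul (μ := 0) (f := fun t => g' t - t * g t)
    (one_ne_zero (α := NNReal))
  simp only [smul_eq_mul] at h5
  rw [hz, integral_sub h2 h1] at h5
  linarith

/-- Stein's identity for the standard Gaussian law, coordinatewise: Fubini in the `k`-th coordinate
reduces it to dimension one. -/
theorem integral_coord_mul_eq_integral_fderiv_stdGaussian {p : ℕ}
    {F : EuclideanSpace ℝ (Fin p) → ℝ} (hF : Differentiable ℝ F) (k : Fin p)
    (h0 : Integrable F (stdGaussian (EuclideanSpace ℝ (Fin p))))
    (h1 : Integrable (fun w => w k * F w) (stdGaussian (EuclideanSpace ℝ (Fin p))))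
    (h2 : Integrable (fun w => fderiv ℝ F w (EuclideanSpace.single k 1))
      (stdGaussian (EuclideanSpace ℝ (Fin p)))) :
    ∫ w, w k * F w ∂(stdGaussian (EuclideanSpace ℝ (Fin p)))
      = ∫ w, fderiv ℝ F w (EuclideanSpace.single k 1)
          ∂(stdGaussian (EuclideanSpace ℝ (Fin p))) := by
  obtain ⟨m, rfl⟩ : ∃ m, p = m + 1 := ⟨p - 1, by have := k.2; omega⟩
  set ins : ℝ × (Fin m → ℝ) → EuclideanSpace ℝ (Fin (m + 1)) :=
    fun z => WithLp.toLp 2 (k.insertNth z.1 z.2) with hins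
  have hmp : MeasurePreserving ins
      ((gaussianReal 0 1).prod (Measure.pi fun _ : Fin m => gaussianReal 0 1))
      (stdGaussian (EuclideanSpace ℝ (Fin (m + 1)))) := by
    have e1 := (measurePreserving_piFinSuccAbove
      (fun _ : Fin (m + 1) => gaussianReal 0 1) k).symm
    have e2 : MeasurePreserving (WithLp.toLp 2)
        (Measure.pi fun _ : Fin (m + 1) => gaussianReal 0 1)
        (stdGaussian (EuclideanSpace ℝ (Fin (m + 1)))) := ⟨by fun_prop, map_pi_eq_stdGaussian⟩
    exact e2.comp e1
  have hline : ∀ (y : Fin m → ℝ) (t : ℝ), HasDerivAt (fun t => F (ins (t, y)))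
      (fderiv ℝ F (ins (t, y)) (EuclideanSpace.single k 1)) t := by
    intro y t
    have e3 : ∀ s, ins (s, y) = ins (t, y) + (s - t) • EuclideanSpace.single k 1 := by
      intro s
      ext i
      simp only [hins, PiLp.add_apply, PiLp.smul_apply, PiLp.single_apply, smul_eq_mul]
      rcases eq_or_ne i k with rfl | hik
      · simp
      · obtain ⟨j, rfl⟩ := Fin.exists_succAbove_eq hik
        simp
    have e4 : HasDerivAt (fun s => ins (s, y)) (EuclideanSpace.single k (1 : ℝ)) t := by
      rw [show (fun s => ins (s, y)) = _ from funext e3]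
      have := (((hasDerivAt_id t).sub_const t).smul_const
        (EuclideanSpace.single k (1 : ℝ))).const_add (ins (t, y))
      simpa using this
    exact (hF (ins (t, y))).hasFDerivAt.comp_hasDerivAt t e4
  have i0 := (hmp.integrable_comp h0.aestronglyMeasurable).2 h0
  have i1 := (hmp.integrable_comp h1.aestronglyMeasurable).2 h1
  have i2 := (hmp.integrable_comp h2.aestronglyMeasurable).2 h2
  simp only [Function.comp_def] at i0 i1 i2
  rw [← hmp.map_eq, integral_map hmp.aemeasurable (hmp.map_eq ▸ h1.aestronglyMeasurable),
    integral_map hmp.aemeasurable (hmp.map_eq ▸ h2.aestronglyMeasurable)]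
  rw [integral_prod_symm _ i1, integral_prod_symm _ i2]
  refine integral_congr_ae ?_
  filter_upwards [i0.prod_left_ae, i1.prod_left_ae, i2.prod_left_ae] with y j0 j1 j2
  have hk : ∀ t, (ins (t, y)) k = t := fun t => by simp [hins]
  simp only [hk] at j0 j1 j2 ⊢
  exact integral_mul_self_eq_integral_deriv_gaussianReal (hline y) j0 j1 j2

end Stein

/-! ### Moments -/

section Moments

/-- A crude fourth moment bound, from `s² / 2 ≤ exp s` with `s = t² / (4v)`. -/
theorem integral_pow_four_gaussianReal_le (v : NNReal) :
    Integrable (fun t : ℝ => t ^ 4) (gaussianReal 0 v) ∧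
      ∫ t, t ^ 4 ∂(gaussianReal 0 v) ≤ 64 * (v : ℝ) ^ 2 := by
  have hi : Integrable (fun t : ℝ => t ^ 4) (gaussianReal 0 v) := by
    have := (IsGaussian.memLp_id (gaussianReal 0 v) 4 (by simp)).integrable_norm_pow (p := 4)
      (by norm_num)
    refine this.congr (ae_of_all _ fun t => ?_)
    simp only [id, Real.norm_eq_abs]
    exact Even.pow_abs (by decide) t
  refine ⟨hi, ?_⟩
  rcases eq_or_ne v 0 with rfl | hv
  · simp [gaussianReal_zero_var]
  have hv0 : (0 : ℝ) < v := by positivity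
  have hmgf := mgf_sq_gaussianReal v (a := 1 / (4 * v)) (by field_simp; norm_num)
  have e : 1 - 2 * (1 / (4 * (v : ℝ))) * v = 1 / 2 := by field_simp; norm_num
  rw [e, mgf] at hmgf
  have hpos : (0 : ℝ) < (√(1 / 2))⁻¹ := by positivity
  have hint : Integrable (fun t : ℝ => Real.exp (1 / (4 * v) * t ^ 2)) (gaussianReal 0 v) := by
    by_contra hcon
    rw [integral_undef hcon] at hmgf
    exact hpos.ne hmgf
  have hle : ∀ t : ℝ, t ^ 4 ≤ 32 * (v : ℝ) ^ 2 * Real.exp (1 / (4 * v) * t ^ 2) := by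
    intro t
    have h1 := Real.quadratic_le_exp_of_nonneg (x := 1 / (4 * (v : ℝ)) * t ^ 2) (by positivity)
    have h2 : (1 / (4 * (v : ℝ)) * t ^ 2) ^ 2 / 2 ≤ Real.exp (1 / (4 * v) * t ^ 2) := by
      have : 0 ≤ 1 / (4 * (v : ℝ)) * t ^ 2 := by positivity
      linarith
    calc t ^ 4 = 32 * (v : ℝ) ^ 2 * ((1 / (4 * (v : ℝ)) * t ^ 2) ^ 2 / 2) := by
          field_simp; ring
      _ ≤ _ := by gcongr
  have h3 : (√(1 / 2))⁻¹ ≤ 2 := by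
    rw [inv_le_comm₀ (by positivity) two_pos]
    exact Real.le_sqrt_of_sq_le (by norm_num)
  calc ∫ t, t ^ 4 ∂(gaussianReal 0 v)
      ≤ ∫ t, 32 * (v : ℝ) ^ 2 * Real.exp (1 / (4 * v) * t ^ 2) ∂(gaussianReal 0 v) :=
        integral_mono hi (hint.const_mul _) hle
    _ = 32 * (v : ℝ) ^ 2 * (√(1 / 2))⁻¹ := by rw [integral_const_mul, hmgf]
    _ ≤ 32 * (v : ℝ) ^ 2 * 2 := by gcongr
    _ = _ := by ring

theorem integral_inner_pow_four_stdGaussian_le {p : ℕ} (u : EuclideanSpace ℝ (Fin p)) :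
    Integrable (fun w => inner ℝ u w ^ 4) (stdGaussian (EuclideanSpace ℝ (Fin p))) ∧
      ∫ w, inner ℝ u w ^ 4 ∂(stdGaussian (EuclideanSpace ℝ (Fin p))) ≤ 64 * (‖u‖ ^ 2) ^ 2 := by
  have hl := hasLaw_inner_stdGaussian (HasLaw.id (μ := stdGaussian (EuclideanSpace ℝ (Fin p)))) u
  simp only [id] at hl
  have hmeas : AEStronglyMeasurable (fun t : ℝ => t ^ 4)
    (gaussianReal 0 (‖u‖ ^ 2).toNNReal) := by fun_prop
  obtain ⟨h1, h2⟩ := integral_pow_four_gaussianReal_le (‖u‖ ^ 2).toNNReal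
  rw [Real.coe_toNNReal _ (by positivity)] at h2
  refine ⟨?_, ?_⟩
  · rw [← hl.map_eq] at h1
    exact h1.comp_aemeasurable hl.aemeasurable
  · rw [← hl.integral_comp hmeas] at h2
    exact h2

/-- For `C < 0` the hypothesis forces `f = 0` almost everywhere, so no sign condition is needed. -/
theorem integral_pow_le_of_eLpNorm_le {α : Type*} [MeasurableSpace α] {γ : Measure α} {f : α → ℝ}
    (hf : AEStronglyMeasurable f γ) {m : ℕ} (hm : m ≠ 0) (hm2 : Even m) {C : ℝ}
    (h : eLpNorm f m γ ≤ ENNReal.ofReal C) :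
    Integrable (fun x => f x ^ m) γ ∧ ∫ x, f x ^ m ∂γ ≤ C ^ m := by
  have hL : MemLp f m γ := ⟨hf, h.trans_lt ENNReal.ofReal_lt_top⟩
  have e : ∀ x, ‖f x‖ ^ m = f x ^ m := fun x => by
    rw [Real.norm_eq_abs, hm2.pow_abs]
  refine ⟨(hL.integrable_norm_pow hm).congr (ae_of_all _ e), ?_⟩
  have h1 := hL.eLpNorm_eq_integral_rpow_norm (by simpa using hm) (by simp)
  simp only [ENNReal.toReal_natCast, Real.rpow_natCast, e] at h1
  rw [h1] at h
  have hnn : 0 ≤ ∫ x, f x ^ m ∂γ := integral_nonneg fun x => hm2.pow_nonneg _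
  have h2 : (∫ x, f x ^ m ∂γ) ^ ((m : ℝ)⁻¹) ≤ max C 0 := by
    rw [← ENNReal.ofReal_le_ofReal_iff (le_max_right _ _)]
    exact h.trans (ENNReal.ofReal_le_ofReal (le_max_left _ _))
  have h3 : ∫ x, f x ^ m ∂γ ≤ (max C 0) ^ m := by
    have := pow_le_pow_left₀ (by positivity) h2 m
    rwa [Real.rpow_inv_natCast_pow hnn hm] at this
  refine h3.trans ?_
  rcases le_total C 0 with hC | hC
  · rw [max_eq_right hC, zero_pow hm]
    exact hm2.pow_nonneg _
  · rw [max_eq_left hC]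

theorem memLp_two_mul_of_pow_four {α : Type*} [MeasurableSpace α] {γ : Measure α} {f g : α → ℝ}
    (hf : AEStronglyMeasurable f γ) (hg : AEStronglyMeasurable g γ)
    (hf4 : Integrable (fun x => f x ^ 4) γ) (hg4 : Integrable (fun x => g x ^ 4) γ) :
    MemLp (fun x => f x * g x) 2 γ ∧
      ∫ x, (f x * g x) ^ 2 ∂γ ≤ (∫ x, f x ^ 4 ∂γ + ∫ x, g x ^ 4 ∂γ) / 2 := by
  have hle : ∀ x, (f x * g x) ^ 2 ≤ (f x ^ 4 + g x ^ 4) / 2 := fun x => by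
    nlinarith [sq_nonneg (f x ^ 2 - g x ^ 2)]
  have hi : Integrable (fun x => (f x ^ 4 + g x ^ 4) / 2) γ := (hf4.add hg4).div_const 2
  have hi2 : Integrable (fun x => (f x * g x) ^ 2) γ := by
    refine hi.mono' ((hf.mul hg).pow 2) (ae_of_all _ fun x => ?_)
    rw [Real.norm_of_nonneg (sq_nonneg _)]
    exact hle x
  refine ⟨(memLp_two_iff_integrable_sq (hf.mul hg)).2 hi2, ?_⟩
  rw [← integral_add hf4 hg4, ← integral_div]
  exact integral_mono hi2 hi hle

variable {Ω E : Type*} [MeasurableSpace Ω] [MeasurableSpace E] {μ : Measure Ω} {γ : Measure E} {n : ℕ} {w : Fin n → Ω → E}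

/-- Mean square error of the sample mean of an i.i.d. sample. -/
theorem integral_sq_sampleMean_sub_le [IsProbabilityMeasure μ] (hn : 0 < n) (hw : ∀ i, HasLaw (w i) γ μ)
    (hind : iIndepFun w μ) {φ : E → ℝ} (hφ : Measurable φ) (hφ2 : MemLp φ 2 γ) :
    Integrable (fun ω => ((1 / (n : ℝ)) * ∑ i, φ (w i ω) - ∫ x, φ x ∂γ) ^ 2) μ ∧
      ∫ ω, ((1 / (n : ℝ)) * ∑ i, φ (w i ω) - ∫ x, φ x ∂γ) ^ 2 ∂μ ≤ (∫ x, φ x ^ 2 ∂γ) / n := by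
  have hn0 : (0 : ℝ) < n := by exact_mod_cast hn
  have hX2 : ∀ i, MemLp (fun ω => φ (w i ω)) 2 μ := fun i => by
    have := hφ2
    rw [← (hw i).map_eq] at this
    exact this.comp_of_map (hw i).aemeasurable
  have hmean : ∀ i, ∫ ω, φ (w i ω) ∂μ = ∫ x, φ x ∂γ := fun i =>
    (hw i).integral_comp hφ.aestronglyMeasurable
  have hsq : ∀ i, ∫ ω, φ (w i ω) ^ 2 ∂μ = ∫ x, φ x ^ 2 ∂γ := fun i =>
    (hw i).integral_comp (f := fun x => φ x ^ 2) (hφ.pow_const 2).aestronglyMeasurable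
  have hsumL : MemLp (fun ω => ∑ i, φ (w i ω)) 2 μ := memLp_finsetSum _ fun i _ => hX2 i
  have hVar : Var[fun ω => ∑ i, φ (w i ω); μ] ≤ n * ∫ x, φ x ^ 2 ∂γ := by
    have h1 := IndepFun.variance_sum (s := Finset.univ) (X := fun i ω => φ (w i ω))
      (μ := μ) (fun i _ => hX2 i) (fun i _ j _ hij =>
        (hind.indepFun hij).comp hφ hφ)
    have h2 : (∑ i, fun ω => φ (w i ω)) = fun ω => ∑ i, φ (w i ω) := by ext; simp
    rw [h2] at h1
    rw [h1]
    calc ∑ i, Var[fun ω => φ (w i ω); μ] ≤ ∑ i : Fin n, ∫ x, φ x ^ 2 ∂γ := by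
          refine Finset.sum_le_sum fun i _ => ?_
          rw [← hsq i]
          exact variance_le_expectation_sq (hX2 i).aestronglyMeasurable
      _ = _ := by simp
  have hE : ∫ ω, ∑ i, φ (w i ω) ∂μ = n * ∫ x, φ x ∂γ := by
    rw [integral_finsetSum _ fun i _ => (hX2 i).integrable one_le_two]
    simp [hmean]
  have e : ∀ ω, ((1 / (n : ℝ)) * ∑ i, φ (w i ω) - ∫ x, φ x ∂γ) ^ 2
      = (1 / (n : ℝ)) ^ 2 * (∑ i, φ (w i ω) - ∫ ω, ∑ i, φ (w i ω) ∂μ) ^ 2 := fun ω => by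
    rw [hE]; field_simp
  simp_rw [e]
  refine ⟨((hsumL.sub (memLp_const _)).integrable_sq).const_mul _, ?_⟩
  rw [integral_const_mul, ← variance_eq_integral hsumL.aestronglyMeasurable.aemeasurable]
  calc (1 / (n : ℝ)) ^ 2 * Var[fun ω => ∑ i, φ (w i ω); μ]
      ≤ (1 / (n : ℝ)) ^ 2 * (n * ∫ x, φ x ^ 2 ∂γ) := by gcongr
    _ = _ := by field_simp

/-- Mean square of the average of `φ(wᵢ) eᵢ` with independent centred noise `eᵢ`: the cross terms
vanish because the noise is centred, independent across `i`, and independent of `w`. -/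
theorem integral_sq_sampleMean_noise_le (hn : 0 < n) (hw : ∀ i, HasLaw (w i) γ μ)
    {φ : E → ℝ} (hφ : Measurable φ) (hφ2 : MemLp φ 2 γ)
    {ν : Measure ℝ} {e : Fin n → Ω → ℝ} (he : ∀ i, HasLaw (e i) ν μ) (hei : iIndepFun e μ)
    (hν : MemLp id 2 ν) (hν0 : ∫ t, t ∂ν = 0)
    (hwe : IndepFun (fun ω i => w i ω) (fun ω i => e i ω) μ) :
    Integrable (fun ω => ((1 / (n : ℝ)) * ∑ i, φ (w i ω) * e i ω) ^ 2) μ ∧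
      ∫ ω, ((1 / (n : ℝ)) * ∑ i, φ (w i ω) * e i ω) ^ 2 ∂μ
        ≤ (∫ x, φ x ^ 2 ∂γ) * (∫ t, t ^ 2 ∂ν) / n := by
  have hn0 : (0 : ℝ) < n := by exact_mod_cast hn
  have hX2 : ∀ i, MemLp (fun ω => φ (w i ω)) 2 μ := fun i => by
    have := hφ2
    rw [← (hw i).map_eq] at this
    exact this.comp_of_map (hw i).aemeasurable
  have he2 : ∀ i, MemLp (e i) 2 μ := fun i => by
    have := hν
    rw [← (he i).map_eq] at this
    exact this.comp_of_map (he i).aemeasurable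
  have hsq : ∀ i, ∫ ω, φ (w i ω) ^ 2 ∂μ = ∫ x, φ x ^ 2 ∂γ := fun i =>
    (hw i).integral_comp (f := fun x => φ x ^ 2) (hφ.pow_const 2).aestronglyMeasurable
  have hesq : ∀ i, ∫ ω, e i ω ^ 2 ∂μ = ∫ t, t ^ 2 ∂ν := fun i =>
    (he i).integral_comp (f := fun t => t ^ 2) (by fun_prop)
  have hemean : ∀ i, ∫ ω, e i ω ∂μ = 0 := fun i => by
    rw [← hν0]; exact (he i).integral_comp (f := fun t => t) (by fun_prop)
  have hpair : ∀ i j, IndepFun (fun ω => φ (w i ω) * φ (w j ω)) (fun ω => e i ω * e j ω) μ :=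
    fun i j => hwe.comp (φ := fun x : Fin n → E => φ (x i) * φ (x j))
      (ψ := fun t : Fin n → ℝ => t i * t j)
      ((hφ.comp (measurable_pi_apply i)).mul (hφ.comp (measurable_pi_apply j)))
      (by fun_prop)
  have hiX : ∀ i j, Integrable (fun ω => φ (w i ω) * φ (w j ω)) μ := fun i j =>
    (hX2 i).integrable_mul (hX2 j)
  have hie : ∀ i j, Integrable (fun ω => e i ω * e j ω) μ := fun i j =>
    (he2 i).integrable_mul (he2 j)
  have hi : ∀ i j, Integrable (fun ω => (φ (w i ω) * φ (w j ω)) * (e i ω * e j ω)) μ :=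
    fun i j => (hpair i j).integrable_mul (hiX i j) (hie i j)
  have hval : ∀ i j, ∫ ω, (φ (w i ω) * φ (w j ω)) * (e i ω * e j ω) ∂μ
      = if i = j then (∫ x, φ x ^ 2 ∂γ) * (∫ t, t ^ 2 ∂ν) else 0 := by
    intro i j
    rw [(hpair i j).integral_fun_mul_eq_mul_integral (hiX i j).aestronglyMeasurable
      (hie i j).aestronglyMeasurable]
    split_ifs with hij
    · subst hij
      rw [← hsq i, ← hesq i]
      simp only [sq]
    · rw [(hei.indepFun hij).integral_fun_mul_eq_mul_integral (he2 i).aestronglyMeasurable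
        (he2 j).aestronglyMeasurable, hemean, zero_mul, mul_zero]
  have e1 : ∀ ω, ((1 / (n : ℝ)) * ∑ i, φ (w i ω) * e i ω) ^ 2
      = (1 / (n : ℝ)) ^ 2 * ∑ i, ∑ j, (φ (w i ω) * φ (w j ω)) * (e i ω * e j ω) := fun ω => by
    rw [mul_pow, sq (∑ i, _), Finset.sum_mul_sum]
    congr 1
    refine Finset.sum_congr rfl fun i _ => Finset.sum_congr rfl fun j _ => by ring
  simp_rw [e1]
  have hI : ∀ i, Integrable (fun ω => ∑ j, (φ (w i ω) * φ (w j ω)) * (e i ω * e j ω)) μ :=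
    fun i => integrable_finsetSum _ fun j _ => hi i j
  refine ⟨(integrable_finsetSum _ fun i _ => hI i).const_mul _, le_of_eq ?_⟩
  rw [integral_const_mul, integral_finsetSum _ fun i _ => hI i]
  rw [Finset.sum_congr rfl fun i _ => integral_finsetSum _ fun j _ => hi i j]
  simp only [hval, Finset.sum_ite_eq, Finset.mem_univ, if_true, Finset.sum_const, Finset.card_univ,
    Fintype.card_fin, nsmul_eq_mul]
  field_simp

end Moments

/-! ### Whitening -/

section Whitening

variable {n p q r : ℕ}

theorem mul_frobNorm_le_left {l m : ℕ} {L : Matrix (Fin l) (Fin m) ℝ} {c : ℝ} (hc : 0 ≤ c)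
    (h : ∀ v, c ^ 2 * (v ⬝ᵥ v) ≤ (L *ᵥ v) ⬝ᵥ (L *ᵥ v)) (X : Matrix (Fin m) (Fin n) ℝ) :
    c * frobNorm X ≤ frobNorm (L * X) := by
  have h1 := mul_frobNorm_le (M := Lᵀ) hc (fun v => by
    rw [Matrix.vecMul_transpose]; exact h v) Xᵀ
  rwa [← Matrix.transpose_mul, frobNorm_transpose, frobNorm_transpose] at h1

/-- A lower bound on the eigenvalues is a lower bound on the quadratic form. -/
theorem Matrix.IsHermitian.mul_dotProduct_le {S : Matrix (Fin p) (Fin p) ℝ} (hS : S.IsHermitian)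
    {c : ℝ} (hc : ∀ i, c ≤ hS.eigenvalues i) (v : Fin p → ℝ) :
    c * (v ⬝ᵥ v) ≤ v ⬝ᵥ (S *ᵥ v) := by
  set b := hS.eigenvectorBasis with hb
  have hSt : Sᵀ = S := by simpa using hS.eq
  have hin : ∀ x y : EuclideanSpace ℝ (Fin p), inner ℝ x y = x.ofLp ⬝ᵥ y.ofLp := fun x y => by
    rw [EuclideanSpace.inner_eq_star_dotProduct, star_trivial, dotProduct_comm]
  have h1 : ∀ i, inner ℝ (b i) (WithLp.toLp 2 (S *ᵥ v))
      = hS.eigenvalues i * inner ℝ (b i) (WithLp.toLp 2 v) := fun i => by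
    rw [hin, hin, Matrix.dotProduct_mulVec]
    simp only
    rw [← Matrix.mulVec_transpose, hSt, hb, hS.mulVec_eigenvectorBasis, smul_dotProduct,
      smul_eq_mul]
  have h2 := b.sum_inner_mul_inner (WithLp.toLp 2 v) (WithLp.toLp 2 (S *ᵥ v))
  have h3 := b.sum_inner_mul_inner (WithLp.toLp 2 v) (WithLp.toLp 2 v)
  rw [hin] at h2 h3
  simp only at h2 h3
  rw [← h2, ← h3, Finset.mul_sum]
  refine Finset.sum_le_sum fun i _ => ?_
  rw [h1, real_inner_comm]
  nlinarith [hc i, sq_nonneg (inner ℝ (b i) (WithLp.toLp 2 v) : ℝ)]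

open scoped MatrixOrder in
/-- The symmetric square root of the covariance matrix, which transports the standard Gaussian law
to `N(0, S)`. -/
theorem exists_sqrt_multivariateGaussian {S : Matrix (Fin p) (Fin p) ℝ} (hS : S.PosDef) :
    ∃ R : Matrix (Fin p) (Fin p) ℝ, Rᵀ = R ∧ R * R = S ∧ IsUnit R.det ∧
      multivariateGaussian 0 S
        = (stdGaussian (EuclideanSpace ℝ (Fin p))).map R.toEuclideanLin := by
  have hRp : (CFC.sqrt S).PosSemidef := Matrix.nonneg_iff_posSemidef.1 (CFC.sqrt_nonneg _)
  have hRR : CFC.sqrt S * CFC.sqrt S = S := CFC.sqrt_mul_sqrt_self _ hS.posSemidef.nonneg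
  refine ⟨CFC.sqrt S, by simpa using hRp.isHermitian.eq, hRR, ?_, ?_⟩
  · have h1 := hS.det_pos
    rw [← hRR, Matrix.det_mul] at h1
    exact isUnit_iff_ne_zero.2 fun h => by simp [h] at h1
  · simp only [multivariateGaussian, zero_add]
    rfl

theorem ofLp_toEuclideanLin (M : Matrix (Fin p) (Fin q) ℝ) (v : EuclideanSpace ℝ (Fin q)) :
    (M.toEuclideanLin v).ofLp = M *ᵥ v.ofLp := rfl

/-- The matrix whose rows are the given vectors. -/
def rowMatrix (w : Fin n → EuclideanSpace ℝ (Fin p)) : Matrix (Fin n) (Fin p) ℝ :=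
  Matrix.of fun i => (w i).ofLp

theorem scoreCrossMoment_eq {s : EuclideanSpace ℝ (Fin p) → EuclideanSpace ℝ (Fin p)}
    {x w : Fin n → EuclideanSpace ℝ (Fin p)} {L : Matrix (Fin p) (Fin p) ℝ}
    (h : ∀ i, (s (x i)).ofLp = L *ᵥ (w i).ofLp) (y : Fin n → Fin q → ℝ) :
    scoreCrossMoment s x y = L * ((1 / (n : ℝ)) • ((rowMatrix w)ᵀ * Matrix.of y)) := by
  rw [scoreCrossMoment, Matrix.mul_smul, ← Matrix.mul_assoc]
  congr 1
  ext k j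
  rw [Matrix.sum_apply, Matrix.mul_apply]
  refine Finset.sum_congr rfl fun i _ => ?_
  rw [Matrix.vecMulVec_apply, h]
  simp [rowMatrix, Matrix.mul_apply, Matrix.mulVec, dotProduct]

theorem sampleCov_eq {x w : Fin n → EuclideanSpace ℝ (Fin p)} {R : Matrix (Fin p) (Fin p) ℝ}
    (hR : Rᵀ = R) (h : ∀ i, (x i).ofLp = R *ᵥ (w i).ofLp) :
    sampleCov x = R * ((1 / (n : ℝ)) • ((rowMatrix w)ᵀ * rowMatrix w)) * R := by
  have h1 := scoreCrossMoment_eq (s := id) (x := x) (w := w) (L := R) h fun i => (x i).ofLp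
  have h2 : (Matrix.of fun i => (x i).ofLp) = rowMatrix w * R := by
    ext i k
    rw [Matrix.of_apply, h, Matrix.mul_apply]
    conv_lhs => rw [← hR]
    simp [rowMatrix, Matrix.mulVec, dotProduct, mul_comm]
  rw [h2, ← Matrix.mul_assoc, ← Matrix.smul_mul, ← Matrix.mul_assoc] at h1
  exact h1

variable {x w : Fin n → EuclideanSpace ℝ (Fin p)} {y : Fin n → Fin q → ℝ}
  {S R : Matrix (Fin p) (Fin p) ℝ}

theorem sqrt_mul_frobNorm_le {c : ℝ} (hc : 0 < c) (hR : Rᵀ = R) (hRR : R * R = S)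
    (hS : ∀ v, c * (v ⬝ᵥ v) ≤ v ⬝ᵥ (S *ᵥ v)) (X : Matrix (Fin p) (Fin q) ℝ) :
    √c * frobNorm X ≤ frobNorm (R * X) := by
  refine mul_frobNorm_le_left (Real.sqrt_nonneg c) (fun v => ?_) X
  rw [Real.sq_sqrt hc.le, dotProduct_mulVec_self, hR, hRR]
  exact hS v

/-- Error of the cross moment with the true score, in whitened coordinates. -/
theorem frobNorm_trueScore_sub_le {c : ℝ} (hc : 0 < c) (hSp : S.PosDef) (hR : Rᵀ = R)
    (hRR : R * R = S) (hdet : IsUnit R.det) (hS : ∀ v, c * (v ⬝ᵥ v) ≤ v ⬝ᵥ (S *ᵥ v))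
    (hx : ∀ i, (x i).ofLp = R *ᵥ (w i).ofLp) (A₀ : Matrix (Fin p) (Fin q) ℝ) :
    √c * frobNorm (scoreCrossMoment (firstOrderScore (gaussianDensity S)) x y - A₀)
      ≤ frobNorm ((1 / (n : ℝ)) • ((rowMatrix w)ᵀ * Matrix.of y) - R * A₀) := by
  have h1 := scoreCrossMoment_eq (s := firstOrderScore (gaussianDensity S)) (x := x) (w := w)
    (L := R⁻¹) (fun i => by
      rw [firstOrderScore_gaussianDensity hSp, ofLp_toEuclideanLin, hx,
        Matrix.mulVec_mulVec, ← hRR, Matrix.mul_inv_rev, Matrix.mul_assoc,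
        Matrix.nonsing_inv_mul _ hdet, Matrix.mul_one]) y
  refine (sqrt_mul_frobNorm_le hc hR hRR hS _).trans_eq ?_
  rw [h1, Matrix.mul_sub, ← Matrix.mul_assoc, Matrix.mul_nonsing_inv _ hdet, Matrix.one_mul]

/-- Error of the plug-in cross moment: when the whitened Gram matrix is well conditioned it is the
least-squares error, governed by the correlation of the features with the linear residuals. -/
theorem frobNorm_plugIn_sub_le {c κ : ℝ} (hc : 0 < c) (hκ : 0 < κ) (hR : Rᵀ = R)
    (hRR : R * R = S) (hdet : IsUnit R.det) (hS : ∀ v, c * (v ⬝ᵥ v) ≤ v ⬝ᵥ (S *ᵥ v))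
    (hx : ∀ i, (x i).ofLp = R *ᵥ (w i).ofLp) (hn : 0 < n)
    (hG : ∀ u, κ * n * ‖u‖ ^ 2 ≤ ∑ i, inner ℝ u (w i) ^ 2)
    {P : Matrix (Fin p) (Fin p) ℝ} (hP : IsMoorePenroseInverse (sampleCov x) P)
    (A₀ : Matrix (Fin p) (Fin q) ℝ) :
    κ * √c * frobNorm (scoreCrossMoment (fun u => P.toEuclideanLin u) x y - A₀)
      ≤ frobNorm ((1 / (n : ℝ)) •
          ((rowMatrix w)ᵀ * (Matrix.of y - rowMatrix w * (R * A₀)))) := by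
  have hn0 : (0 : ℝ) < n := by exact_mod_cast hn
  set W := rowMatrix w with hW
  set G := (1 / (n : ℝ)) • (Wᵀ * W) with hGdef
  have hquad : ∀ v, κ * (v ⬝ᵥ v) ≤ v ⬝ᵥ (G *ᵥ v) := fun v => by
    have h1 := hG (WithLp.toLp 2 v)
    rw [← dotProduct_self_eq_norm_sq] at h1
    have h2 : v ⬝ᵥ (G *ᵥ v) = (1 / (n : ℝ)) * ∑ i, inner ℝ (WithLp.toLp 2 v) (w i) ^ 2 := by
      rw [hGdef, Matrix.smul_mulVec, dotProduct_smul, ← dotProduct_mulVec_self, smul_eq_mul]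
      congr 1
      simp [dotProduct, Matrix.mulVec, hW, rowMatrix, PiLp.inner_apply, sq]
    rw [h2, one_div, le_inv_mul_iff₀ hn0]
    simp only at h1
    linarith
  -- expand `‖G v - κ v‖² ≥ 0`
  have hGlow : ∀ v, κ ^ 2 * (v ⬝ᵥ v) ≤ (G *ᵥ v) ⬝ᵥ (G *ᵥ v) := fun v => by
    have h3 := dotProduct_self_nonneg' (G *ᵥ v - κ • v)
    simp only [sub_dotProduct, dotProduct_sub, smul_dotProduct, dotProduct_smul, smul_eq_mul] at h3
    rw [dotProduct_comm (G *ᵥ v) v] at h3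
    nlinarith [hquad v]
  have hGdet : IsUnit G.det := by
    refine isUnit_iff_ne_zero.2 fun h0 => ?_
    obtain ⟨v, hv, hv0⟩ := Matrix.exists_mulVec_eq_zero_iff.2 h0
    have := hquad v
    rw [hv0, dotProduct_zero] at this
    nlinarith [dotProduct_self_pos hv]
  have hcov := sampleCov_eq hR hx
  rw [← hW, ← hGdef] at hcov
  have hcovdet : IsUnit (sampleCov x).det := by
    rw [hcov, Matrix.det_mul, Matrix.det_mul]
    exact (hdet.mul hGdet).mul hdet
  -- the first Penrose equation makes `P` a genuine inverse
  have hinv : sampleCov x * P = 1 := by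
    have h4 : sampleCov x * P * sampleCov x * (sampleCov x)⁻¹
        = sampleCov x * (sampleCov x)⁻¹ := by rw [hP.1]
    rwa [Matrix.mul_assoc, Matrix.mul_nonsing_inv _ hcovdet, Matrix.mul_one] at h4
  have h5 := scoreCrossMoment_eq (s := fun u => P.toEuclideanLin u) (x := x) (w := w)
    (L := P * R) (fun i => by
      rw [ofLp_toEuclideanLin, hx, Matrix.mulVec_mulVec]) y
  have h6 : G * (R * scoreCrossMoment (fun u => P.toEuclideanLin u) x y)
      = (1 / (n : ℝ)) • (Wᵀ * Matrix.of y) := by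
    have h7 : R * (G * (R * (P * R))) = R := by
      have : R * G * R * P * R = R := by rw [← hcov, hinv, Matrix.one_mul]
      simpa only [Matrix.mul_assoc] using this
    have h8 : G * (R * (P * R)) = 1 := by
      have h9 : R⁻¹ * (R * (G * (R * (P * R)))) = R⁻¹ * R := by rw [h7]
      rwa [← Matrix.mul_assoc, Matrix.nonsing_inv_mul _ hdet, Matrix.one_mul] at h9
    rw [h5, ← Matrix.mul_assoc, ← Matrix.mul_assoc, Matrix.mul_assoc G, h8, Matrix.one_mul]
  have h10 : (1 / (n : ℝ)) • (Wᵀ * (Matrix.of y - W * (R * A₀)))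
      = G * (R * (scoreCrossMoment (fun u => P.toEuclideanLin u) x y - A₀)) := by
    rw [Matrix.mul_sub R, Matrix.mul_sub G, h6, Matrix.mul_sub, smul_sub, hGdef, Matrix.smul_mul,
      Matrix.mul_assoc]
  rw [h10, mul_assoc]
  refine le_trans ?_ (mul_frobNorm_le_left hκ.le hGlow _)
  gcongr
  exact sqrt_mul_frobNorm_le hc hR hRR hS _

end Whitening

/-! ### Gaussian regression moments -/

section Regression

variable {p : ℕ} {F : EuclideanSpace ℝ (Fin p) → ℝ} {b : EuclideanSpace ℝ (Fin p)}

theorem inner_single_one (k : Fin p) (w : EuclideanSpace ℝ (Fin p)) :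
    inner ℝ (EuclideanSpace.single k (1 : ℝ)) w = w k := by
  simp [EuclideanSpace.inner_single_left]

theorem integral_coord_pow_four_le (k : Fin p) :
    Integrable (fun w : EuclideanSpace ℝ (Fin p) => w k ^ 4)
        (stdGaussian (EuclideanSpace ℝ (Fin p))) ∧
      ∫ w : EuclideanSpace ℝ (Fin p), w k ^ 4 ∂(stdGaussian (EuclideanSpace ℝ (Fin p))) ≤ 64 := by
  have h := integral_inner_pow_four_stdGaussian_le (EuclideanSpace.single k (1 : ℝ))
  simpa only [inner_single_one, PiLp.norm_single, norm_one, one_pow, mul_one] using h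

theorem memLp_inner_stdGaussian (u : EuclideanSpace ℝ (Fin p)) :
    MemLp (fun w => inner ℝ u w) 2 (stdGaussian (EuclideanSpace ℝ (Fin p))) :=
  IsGaussian.memLp_two_id.const_inner u

theorem integral_coord_mul_inner_stdGaussian (k : Fin p) (u : EuclideanSpace ℝ (Fin p)) :
    ∫ w : EuclideanSpace ℝ (Fin p), w k * inner ℝ u w
      ∂(stdGaussian (EuclideanSpace ℝ (Fin p))) = u k := by
  have hd : ∀ w, fderiv ℝ (fun w : EuclideanSpace ℝ (Fin p) => inner ℝ u w) w = innerSL ℝ u :=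
    fun w => (innerSL ℝ u).hasFDerivAt.fderiv
  have hdiff : Differentiable ℝ fun w : EuclideanSpace ℝ (Fin p) => inner ℝ u w :=
    (innerSL ℝ u).differentiable
  have hk : MemLp (fun w : EuclideanSpace ℝ (Fin p) => w k) 2
      (stdGaussian (EuclideanSpace ℝ (Fin p))) := by
    simpa only [inner_single_one] using memLp_inner_stdGaussian (EuclideanSpace.single k (1 : ℝ))
  rw [integral_coord_mul_eq_integral_fderiv_stdGaussian hdiff k
    ((memLp_inner_stdGaussian u).integrable one_le_two)
    (hk.integrable_mul (memLp_inner_stdGaussian u))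
    (by simp only [hd]; exact integrable_const _)]
  simp only [hd, innerSL_apply_apply]
  rw [real_inner_comm, inner_single_one]
  simp

theorem memLp_two_of_pow_four {α : Type*} [MeasurableSpace α] {γ : Measure α}
    [IsProbabilityMeasure γ] {f : α → ℝ} (hf : AEStronglyMeasurable f γ)
    (h4 : Integrable (fun x => f x ^ 4) γ) : MemLp f 2 γ ∧
      ∫ x, f x ^ 2 ∂γ ≤ (∫ x, f x ^ 4 ∂γ + 1) / 2 := by
  simpa using memLp_two_mul_of_pow_four hf (aestronglyMeasurable_const (b := (1 : ℝ))) h4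
    (integrable_const _)

/-- Bessel's inequality for the regression of `F` on the coordinates, which are orthonormal in
`L²` of the standard Gaussian law. -/
theorem norm_sq_le_integral_sq (hF : MemLp F 2 (stdGaussian (EuclideanSpace ℝ (Fin p))))
    (hb : ∀ k, ∫ w, w k * F w ∂(stdGaussian (EuclideanSpace ℝ (Fin p))) = b k) :
    ‖b‖ ^ 2 ≤ ∫ w, F w ^ 2 ∂(stdGaussian (EuclideanSpace ℝ (Fin p))) := by
  have hk : ∀ k, MemLp (fun w : EuclideanSpace ℝ (Fin p) => w k) 2
      (stdGaussian (EuclideanSpace ℝ (Fin p))) := fun k => by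
    simpa only [inner_single_one] using memLp_inner_stdGaussian (EuclideanSpace.single k (1 : ℝ))
  have hsum : ∀ H : EuclideanSpace ℝ (Fin p) → ℝ,
      MemLp H 2 (stdGaussian (EuclideanSpace ℝ (Fin p))) →
      (∀ k, ∫ w, w k * H w ∂(stdGaussian (EuclideanSpace ℝ (Fin p))) = b k) →
      ∫ w, inner ℝ b w * H w ∂(stdGaussian (EuclideanSpace ℝ (Fin p))) = ‖b‖ ^ 2 := by
    intro H hH hHb
    have e : ∀ w : EuclideanSpace ℝ (Fin p), inner ℝ b w * H w = ∑ k, b k * (w k * H w) := fun w => by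
      rw [PiLp.inner_apply, Finset.sum_mul]
      refine Finset.sum_congr rfl fun k _ => ?_
      simp
      ring
    have hi : ∀ k, Integrable (fun w : EuclideanSpace ℝ (Fin p) => b k * (w k * H w))
        (stdGaussian (EuclideanSpace ℝ (Fin p))) := fun k =>
      ((hk k).integrable_mul hH).const_mul (b k)
    simp_rw [e]
    rw [integral_finsetSum _ fun k _ => hi k]
    simp only [integral_const_mul, hHb]
    rw [EuclideanSpace.real_norm_sq_eq]
    simp only [sq]
  have hbL := memLp_inner_stdGaussian b
  have h1 := hsum F hF hb
  have h2 := hsum _ hbL fun k => integral_coord_mul_inner_stdGaussian k b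
  have h3 : 0 ≤ ∫ w, (F w - inner ℝ b w) ^ 2 ∂(stdGaussian (EuclideanSpace ℝ (Fin p))) :=
    integral_nonneg fun w => sq_nonneg _
  have e : ∀ w, (F w - inner ℝ b w) ^ 2
      = F w ^ 2 - 2 * (inner ℝ b w * F w) + inner ℝ b w * inner ℝ b w := fun w => by ring
  simp_rw [e] at h3
  have i2 : Integrable (fun w => 2 * (inner ℝ b w * F w))
    (stdGaussian (EuclideanSpace ℝ (Fin p))) := (hbL.integrable_mul hF).const_mul 2
  have i3 : Integrable (fun w => inner ℝ b w * inner ℝ b w)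
    (stdGaussian (EuclideanSpace ℝ (Fin p))) := hbL.integrable_mul hbL
  have i12 : Integrable (fun w => F w ^ 2 - 2 * (inner ℝ b w * F w))
    (stdGaussian (EuclideanSpace ℝ (Fin p))) := hF.integrable_sq.sub i2
  rw [integral_add i12 i3, integral_sub hF.integrable_sq i2, integral_const_mul] at h3
  rw [h1, h2] at h3
  linarith

theorem integral_coord_mul_sq_le (k : Fin p)
    (hF : AEStronglyMeasurable F (stdGaussian (EuclideanSpace ℝ (Fin p)))) {C : ℝ}
    (h4 : Integrable (fun w => F w ^ 4) (stdGaussian (EuclideanSpace ℝ (Fin p))))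
    (hC : ∫ w, F w ^ 4 ∂(stdGaussian (EuclideanSpace ℝ (Fin p))) ≤ C) :
    MemLp (fun w => w k * F w) 2 (stdGaussian (EuclideanSpace ℝ (Fin p))) ∧
      ∫ w, (w k * F w) ^ 2 ∂(stdGaussian (EuclideanSpace ℝ (Fin p))) ≤ (64 + C) / 2 := by
  obtain ⟨h1, h2⟩ := integral_coord_pow_four_le k
  obtain ⟨h3, h5⟩ := memLp_two_mul_of_pow_four (by fun_prop) hF h1 h4
  exact ⟨h3, h5.trans (by linarith)⟩

/-- A coordinate times the residual of the linear regression of `F` is centred, with controlled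
second moment. -/
theorem integral_coord_mul_residual (k : Fin p)
    (hF : AEStronglyMeasurable F (stdGaussian (EuclideanSpace ℝ (Fin p)))) {C : ℝ}
    (h4 : Integrable (fun w => F w ^ 4) (stdGaussian (EuclideanSpace ℝ (Fin p))))
    (hC : ∫ w, F w ^ 4 ∂(stdGaussian (EuclideanSpace ℝ (Fin p))) ≤ C)
    (hb : ∀ k, ∫ w, w k * F w ∂(stdGaussian (EuclideanSpace ℝ (Fin p))) = b k) :
    MemLp (fun w => w k * (F w - inner ℝ b w)) 2 (stdGaussian (EuclideanSpace ℝ (Fin p))) ∧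
      ∫ w, w k * (F w - inner ℝ b w) ∂(stdGaussian (EuclideanSpace ℝ (Fin p))) = 0 ∧
      ∫ w, (w k * (F w - inner ℝ b w)) ^ 2 ∂(stdGaussian (EuclideanSpace ℝ (Fin p)))
        ≤ (64 + 8 * (C + 64 * (1 + C) ^ 2)) / 2 := by
  obtain ⟨hF2, hF2le⟩ := memLp_two_of_pow_four hF h4
  obtain ⟨i1, i2⟩ := integral_inner_pow_four_stdGaussian_le b
  have hC0 : 0 ≤ C := le_trans (integral_nonneg fun w => by positivity) hC
  have hbn : ‖b‖ ^ 2 ≤ 1 + C := by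
    have := norm_sq_le_integral_sq hF2 hb
    linarith
  have hm : AEStronglyMeasurable (fun w => F w - inner ℝ b w)
      (stdGaussian (EuclideanSpace ℝ (Fin p))) := hF.sub (by fun_prop)
  have hle : ∀ w, (F w - inner ℝ b w) ^ 4 ≤ 8 * (F w ^ 4 + inner ℝ b w ^ 4) := fun w => by
    have e1 : (F w - inner ℝ b w) ^ 2 ≤ 2 * (F w ^ 2 + inner ℝ b w ^ 2) := by
      nlinarith [sq_nonneg (F w + inner ℝ b w)]
    calc (F w - inner ℝ b w) ^ 4 = ((F w - inner ℝ b w) ^ 2) ^ 2 := by ring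
      _ ≤ (2 * (F w ^ 2 + inner ℝ b w ^ 2)) ^ 2 := by gcongr
      _ ≤ _ := by nlinarith [sq_nonneg (F w ^ 2 - inner ℝ b w ^ 2)]
  have hi : Integrable (fun w => 8 * (F w ^ 4 + inner ℝ b w ^ 4))
    (stdGaussian (EuclideanSpace ℝ (Fin p))) := (h4.add i1).const_mul 8
  have hi4 : Integrable (fun w => (F w - inner ℝ b w) ^ 4)
      (stdGaussian (EuclideanSpace ℝ (Fin p))) := by
    refine hi.mono' (hm.pow 4) (ae_of_all _ fun w => ?_)
    rw [Real.norm_of_nonneg (by positivity)]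
    exact hle w
  have hval : ∫ w, (F w - inner ℝ b w) ^ 4 ∂(stdGaussian (EuclideanSpace ℝ (Fin p)))
      ≤ 8 * (C + 64 * (1 + C) ^ 2) := by
    refine (integral_mono hi4 hi hle).trans ?_
    rw [integral_const_mul, integral_add h4 i1]
    gcongr
    refine i2.trans ?_
    gcongr
  obtain ⟨h5, h6⟩ := integral_coord_mul_sq_le k hm hi4 hval
  refine ⟨h5, ?_, h6⟩
  have hk : MemLp (fun w : EuclideanSpace ℝ (Fin p) => w k) 2
      (stdGaussian (EuclideanSpace ℝ (Fin p))) := by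
    simpa only [inner_single_one] using memLp_inner_stdGaussian (EuclideanSpace.single k (1 : ℝ))
  simp only [mul_sub]
  have j1 : Integrable (fun w : EuclideanSpace ℝ (Fin p) => w k * F w) _ := hk.integrable_mul hF2
  have j2 : Integrable (fun w : EuclideanSpace ℝ (Fin p) => w k * inner ℝ b w) _ :=
    hk.integrable_mul (memLp_inner_stdGaussian b)
  rw [integral_sub j1 j2, hb, integral_coord_mul_inner_stdGaussian, sub_self]

end Regression

/-! ### The nonlinear multiple response model -/

section Model

variable {n p q r : ℕ} {S R : Matrix (Fin p) (Fin p) ℝ} {B : Matrix (Fin p) (Fin r) ℝ}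

theorem measurable_toEuclideanLin (M : Matrix (Fin p) (Fin q) ℝ) :
    Measurable M.toEuclideanLin :=
  (LinearMap.continuous_of_finiteDimensional _).measurable

theorem latent_toEuclideanLin_single (hR : Rᵀ = R) (g : EuclideanSpace ℝ (Fin r)) (k : Fin p) :
    inner ℝ g (latent B (R.toEuclideanLin (EuclideanSpace.single k 1)))
      = ∑ a, (R * B) k a * g a := by
  rw [PiLp.inner_apply]
  refine Finset.sum_congr rfl fun a _ => ?_
  have e : (latent B (R.toEuclideanLin (EuclideanSpace.single k 1))).ofLp a = (R * B) k a := by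
    rw [latent, ofLp_toEuclideanLin, ofLp_toEuclideanLin, Matrix.mulVec_mulVec]
    conv_lhs => rw [← hR, ← Matrix.transpose_mul]
    simp [Matrix.mulVec, dotProduct]
  rw [e]
  simp

/-- Stein's identity in the model: the regression coefficients of a whitened link on the whitened
features are the columns of `R B M₁`, where `R` is the square root of the covariance matrix. -/
theorem integral_coord_mul_link (hR : Rᵀ = R)
    (hlaw : multivariateGaussian 0 S
      = (stdGaussian (EuclideanSpace ℝ (Fin p))).map R.toEuclideanLin)
    (f : Fin q → EuclideanSpace ℝ (Fin r) → ℝ) (hf : ∀ j, Differentiable ℝ (f j))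
    (hgrad : ∀ j, Integrable (fun u => ∇ (f j) (latent B u)) (multivariateGaussian 0 S))
    (j : Fin q)
    (hF : MemLp (fun w => f j (latent B (R.toEuclideanLin w))) 2
      (stdGaussian (EuclideanSpace ℝ (Fin p)))) (k : Fin p) :
    ∫ w : EuclideanSpace ℝ (Fin p), w k * f j (latent B (R.toEuclideanLin w))
        ∂(stdGaussian (EuclideanSpace ℝ (Fin p)))
      = (R * (B * meanGradient S B f)) k j := by
  set T : EuclideanSpace ℝ (Fin p) →L[ℝ] EuclideanSpace ℝ (Fin r) :=
    LinearMap.toContinuousLinearMap (Bᵀ.toEuclideanLin ∘ₗ R.toEuclideanLin) with hT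
  have hTw : ∀ w, T w = latent B (R.toEuclideanLin w) := fun w => rfl
  have hfd : ∀ w, fderiv ℝ (fun w => f j (latent B (R.toEuclideanLin w))) w
      (EuclideanSpace.single k 1)
        = inner ℝ (∇ (f j) (latent B (R.toEuclideanLin w)))
          (latent B (R.toEuclideanLin (EuclideanSpace.single k 1))) := by
    intro w
    have h1 := ((hf j (T w)).hasFDerivAt.comp w T.hasFDerivAt).fderiv
    change fderiv ℝ (f j ∘ T) w _ = _
    rw [h1, ContinuousLinearMap.comp_apply, hTw, hTw, inner_gradient_left]
  have hdiff : Differentiable ℝ fun w => f j (latent B (R.toEuclideanLin w)) :=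
    (hf j).comp T.differentiable
  have hgrad' : Integrable (fun w => ∇ (f j) (latent B (R.toEuclideanLin w)))
      (stdGaussian (EuclideanSpace ℝ (Fin p))) := by
    have h2 := hgrad j
    rw [hlaw] at h2
    exact h2.comp_measurable (measurable_toEuclideanLin R)
  have hk : MemLp (fun w : EuclideanSpace ℝ (Fin p) => w k) 2
      (stdGaussian (EuclideanSpace ℝ (Fin p))) := by
    simpa only [inner_single_one] using memLp_inner_stdGaussian (EuclideanSpace.single k (1 : ℝ))
  rw [integral_coord_mul_eq_integral_fderiv_stdGaussian hdiff k (hF.integrable one_le_two)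
    (hk.integrable_mul hF) (by simp only [hfd]; exact hgrad'.inner_const _)]
  simp only [hfd]
  have hmean : ∀ a, meanGradient S B f a j
      = (∫ w, ∇ (f j) (latent B (R.toEuclideanLin w))
          ∂(stdGaussian (EuclideanSpace ℝ (Fin p)))) a := fun a => by
    simp only [meanGradient, Matrix.of_apply]
    have h2 := (hgrad j).aestronglyMeasurable
    rw [hlaw] at h2
    rw [hlaw, integral_map (measurable_toEuclideanLin R).aemeasurable h2]
  have hin : ∀ v, ∫ w, inner ℝ (∇ (f j) (latent B (R.toEuclideanLin w))) v
      ∂(stdGaussian (EuclideanSpace ℝ (Fin p)))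
      = inner ℝ (∫ w, ∇ (f j) (latent B (R.toEuclideanLin w))
          ∂(stdGaussian (EuclideanSpace ℝ (Fin p)))) v := fun v => by
    rw [real_inner_comm, ← integral_inner hgrad' v]
    simp only [real_inner_comm]
  rw [hin, latent_toEuclideanLin_single hR, ← Matrix.mul_assoc, Matrix.mul_apply]
  simp only [hmean]

theorem frobNorm_sq_le_two_mul {D : Matrix (Fin p) (Fin q) ℝ} {a b : Fin p → Fin q → ℝ}
    (h : ∀ k j, D k j = a k j + b k j) :
    frobNorm D ^ 2 ≤ 2 * ∑ k, ∑ j, (a k j ^ 2 + b k j ^ 2) := by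
  rw [frobNorm_sq, Finset.mul_sum]
  refine Finset.sum_le_sum fun k _ => ?_
  rw [Finset.mul_sum]
  refine Finset.sum_le_sum fun j _ => ?_
  rw [h]
  nlinarith [sq_nonneg (a k j - b k j)]

variable {Ω : Type*} [MeasurableSpace Ω] {μ : Measure Ω} [IsProbabilityMeasure μ]
  {f : Fin q → EuclideanSpace ℝ (Fin r) → ℝ} {ν : Measure ℝ}
  {x : Fin n → Ω → EuclideanSpace ℝ (Fin p)} {e : Fin n → Fin q → Ω → ℝ}
  {y : Fin n → Ω → Fin q → ℝ}

/-- In whitened coordinates both cross-moment errors, the one for the true score and the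
least-squares one, are bounded by `√(2Q)` with a common `Q` of mean `O(qp/n)`. -/
theorem exists_whitened_errors (hn : 0 < n) (hR : Rᵀ = R) (hdet : IsUnit R.det)
    (hlaw : multivariateGaussian 0 S
      = (stdGaussian (EuclideanSpace ℝ (Fin p))).map R.toEuclideanLin)
    (hmodel : IsModelSample μ S B f ν x e y) {Cf σ : ℝ}
    (hσ : eLpNorm id 2 ν ≤ ENNReal.ofReal σ) (hf : ∀ j, Differentiable ℝ (f j))
    (hgrad : ∀ j, Integrable (fun u => ∇ (f j) (latent B u)) (multivariateGaussian 0 S))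
    (hfour : ∀ j, eLpNorm (fun u => f j (latent B u)) 4 (multivariateGaussian 0 S)
      ≤ ENNReal.ofReal Cf) :
    ∃ w : Fin n → Ω → EuclideanSpace ℝ (Fin p),
      (∀ i, HasLaw (w i) (stdGaussian (EuclideanSpace ℝ (Fin p))) μ) ∧ iIndepFun w μ ∧
      (∀ i ω, (x i ω).ofLp = R *ᵥ (w i ω).ofLp) ∧
      ∃ Q : Ω → ℝ, (∀ ω, 0 ≤ Q ω) ∧ Integrable Q μ ∧
        ∫ ω, Q ω ∂μ ≤ (64 + 9 / 2 * Cf ^ 4 + 256 * (1 + Cf ^ 4) ^ 2 + 33 * σ ^ 2) * (q * p / n) ∧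
        ∀ᵐ ω ∂μ,
          frobNorm ((1 / (n : ℝ)) • ((rowMatrix fun i => w i ω)ᵀ * Matrix.of fun i => y i ω)
            - R * (B * meanGradient S B f)) ^ 2 ≤ 2 * Q ω ∧
          frobNorm ((1 / (n : ℝ)) • ((rowMatrix fun i => w i ω)ᵀ * ((Matrix.of fun i => y i ω)
            - (rowMatrix fun i => w i ω) * (R * (B * meanGradient S B f))))) ^ 2 ≤ 2 * Q ω := by
  have hn0 : (0 : ℝ) < n := by exact_mod_cast hn
  set γ := stdGaussian (EuclideanSpace ℝ (Fin p)) with hγ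
  set b : Matrix (Fin p) (Fin q) ℝ := R * (B * meanGradient S B f) with hb
  set F : Fin q → EuclideanSpace ℝ (Fin p) → ℝ :=
    fun j w => f j (latent B (R.toEuclideanLin w)) with hFdef
  have hRi : ∀ u : EuclideanSpace ℝ (Fin p), R⁻¹.toEuclideanLin (R.toEuclideanLin u) = u := by
    intro u
    ext1
    rw [ofLp_toEuclideanLin, ofLp_toEuclideanLin, Matrix.mulVec_mulVec,
      Matrix.nonsing_inv_mul _ hdet, Matrix.one_mulVec]
  have hiR : ∀ u : EuclideanSpace ℝ (Fin p), R.toEuclideanLin (R⁻¹.toEuclideanLin u) = u := by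
    intro u
    ext1
    rw [ofLp_toEuclideanLin, ofLp_toEuclideanLin, Matrix.mulVec_mulVec,
      Matrix.mul_nonsing_inv _ hdet, Matrix.one_mulVec]
  set w : Fin n → Ω → EuclideanSpace ℝ (Fin p) :=
    fun i ω => R⁻¹.toEuclideanLin (x i ω) with hwdef
  have hmR := measurable_toEuclideanLin R
  have hmRi := measurable_toEuclideanLin R⁻¹
  have hw : ∀ i, HasLaw (w i) γ μ := by
    intro i
    have h1 : HasLaw R⁻¹.toEuclideanLin γ (multivariateGaussian 0 S) := by
      refine ⟨hmRi.aemeasurable, ?_⟩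
      rw [hlaw, Measure.map_map hmRi hmR]
      have : (R⁻¹.toEuclideanLin ∘ R.toEuclideanLin) = id := funext hRi
      rw [this, Measure.map_id]
    exact h1.fun_comp (hmodel.law_x i)
  have hind : iIndepFun w μ := hmodel.indep_x.comp (fun _ => R⁻¹.toEuclideanLin) fun _ => hmRi
  have hxw : ∀ i ω, R.toEuclideanLin (w i ω) = x i ω := fun i ω => hiR _
  refine ⟨w, hw, hind, fun i ω => by rw [← hxw i ω, ofLp_toEuclideanLin], ?_⟩
  have hFc : ∀ j, Continuous (F j) := fun j =>
    (hf j).continuous.comp ((LinearMap.continuous_of_finiteDimensional _).comp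
      (LinearMap.continuous_of_finiteDimensional _))
  have hF4 : ∀ j, Integrable (fun w => F j w ^ 4) γ ∧ ∫ w, F j w ^ 4 ∂γ ≤ Cf ^ 4 := by
    intro j
    refine integral_pow_le_of_eLpNorm_le (hFc j).aestronglyMeasurable (by norm_num) (by decide) ?_
    have h1 := hfour j
    have hc : Continuous fun u => f j (latent B u) :=
      (hf j).continuous.comp (LinearMap.continuous_of_finiteDimensional _)
    rw [hlaw, eLpNorm_map_measure hc.aestronglyMeasurable hmR.aemeasurable] at h1
    exact h1
  have hbj : ∀ j k, ∫ w, w k * F j w ∂γ = b k j := fun j k =>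
    integral_coord_mul_link hR hlaw f hf hgrad j
      (memLp_two_of_pow_four (hFc j).aestronglyMeasurable (hF4 j).1).1 k
  have hσ2 := integral_pow_le_of_eLpNorm_le (γ := ν) (f := id) (m := 2) aestronglyMeasurable_id
    two_ne_zero even_two (C := σ) (by simpa using hσ)
  simp only [id] at hσ2
  have hνL : MemLp id 2 ν := ⟨aestronglyMeasurable_id, hσ.trans_lt ENNReal.ofReal_lt_top⟩
  -- `a₁`: error of the mean of `w Fⱼ`; `a₂`: mean of `w` times the linear residual; `a₃`: noise
  set bv : Fin q → EuclideanSpace ℝ (Fin p) := fun j => WithLp.toLp 2 fun k => b k j with hbv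
  set a₁ : Ω → Fin p → Fin q → ℝ := fun ω k j =>
    (1 / (n : ℝ)) * ∑ i, w i ω k * F j (w i ω) - b k j with ha₁
  set a₂ : Ω → Fin p → Fin q → ℝ := fun ω k j =>
    (1 / (n : ℝ)) * ∑ i, w i ω k * (F j (w i ω) - inner ℝ (bv j) (w i ω)) with ha₂
  set a₃ : Ω → Fin p → Fin q → ℝ := fun ω k j =>
    (1 / (n : ℝ)) * ∑ i, w i ω k * e i j ω with ha₃
  have e₁ : ∀ k j, Integrable (fun ω => a₁ ω k j ^ 2) μ ∧
      ∫ ω, a₁ ω k j ^ 2 ∂μ ≤ (64 + Cf ^ 4) / 2 / n := by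
    intro k j
    obtain ⟨h1, h2⟩ := integral_coord_mul_sq_le k (hFc j).aestronglyMeasurable (hF4 j).1 (hF4 j).2
    have hm : Measurable fun u : EuclideanSpace ℝ (Fin p) => u k * F j u := by
      have := (hFc j).measurable
      fun_prop
    obtain ⟨h3, h4⟩ := integral_sq_sampleMean_sub_le hn hw hind hm h1
    rw [hbj] at h3 h4
    exact ⟨h3, h4.trans (by gcongr)⟩
  have e₂ : ∀ k j, Integrable (fun ω => a₂ ω k j ^ 2) μ ∧
      ∫ ω, a₂ ω k j ^ 2 ∂μ ≤ (64 + 8 * (Cf ^ 4 + 64 * (1 + Cf ^ 4) ^ 2)) / 2 / n := by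
    intro k j
    obtain ⟨h1, h0, h2⟩ := integral_coord_mul_residual (b := bv j) k (hFc j).aestronglyMeasurable
      (hF4 j).1 (hF4 j).2 fun k => hbj j k
    have hm : Measurable fun u : EuclideanSpace ℝ (Fin p) =>
        u k * (F j u - inner ℝ (bv j) u) := by
      have := (hFc j).measurable
      fun_prop
    obtain ⟨h3, h4⟩ := integral_sq_sampleMean_sub_le hn hw hind hm h1
    rw [h0] at h3 h4
    simp only [sub_zero] at h3 h4
    exact ⟨h3, h4.trans (by gcongr)⟩
  have e₃ : ∀ k j, Integrable (fun ω => a₃ ω k j ^ 2) μ ∧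
      ∫ ω, a₃ ω k j ^ 2 ∂μ ≤ 33 * σ ^ 2 / n := by
    intro k j
    obtain ⟨h1, h2⟩ := integral_coord_pow_four_le k
    obtain ⟨h3, h4⟩ := memLp_two_of_pow_four (by fun_prop) h1
    have hm : Measurable fun u : EuclideanSpace ℝ (Fin p) => u k := by fun_prop
    have hei : iIndepFun (fun i => e i j) μ :=
      hmodel.indep_noise.precomp (g := fun i : Fin n => (i, j)) fun i i' h => by simpa using h
    have hwe : IndepFun (fun ω i => w i ω) (fun ω i => e i j ω) μ :=
      hmodel.indep_x_noise.comp
        (φ := fun (z : Fin n → EuclideanSpace ℝ (Fin p)) i => R⁻¹.toEuclideanLin (z i))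
        (ψ := fun (z : Fin n × Fin q → ℝ) i => z (i, j))
        (measurable_pi_lambda _ fun i => hmRi.comp (measurable_pi_apply i))
        (measurable_pi_lambda _ fun i => measurable_pi_apply _)
    obtain ⟨h5, h6⟩ := integral_sq_sampleMean_noise_le hn hw hm h3
      (fun i => hmodel.law_noise i j) hei hνL hmodel.mean_noise hwe
    refine ⟨h5, h6.trans ?_⟩
    have h7 : 0 ≤ ∫ t, t ^ 2 ∂ν := integral_nonneg fun t => sq_nonneg t
    gcongr
    · exact h4.trans (by linarith)
    · exact hσ2.2
  set Q : Ω → ℝ := fun ω => ∑ k, ∑ j, (a₁ ω k j ^ 2 + a₂ ω k j ^ 2 + a₃ ω k j ^ 2) with hQ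
  have i123 : ∀ k j, Integrable (fun ω => a₁ ω k j ^ 2 + a₂ ω k j ^ 2 + a₃ ω k j ^ 2) μ :=
    fun k j => ((e₁ k j).1.add (e₂ k j).1).add (e₃ k j).1
  refine ⟨Q, fun ω => by positivity,
    integrable_finsetSum _ fun k _ => integrable_finsetSum _ fun j _ => i123 k j, ?_, ?_⟩
  · have hkj : ∀ k j, ∫ ω, (a₁ ω k j ^ 2 + a₂ ω k j ^ 2 + a₃ ω k j ^ 2) ∂μ
        ≤ (64 + 9 / 2 * Cf ^ 4 + 256 * (1 + Cf ^ 4) ^ 2 + 33 * σ ^ 2) / n := by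
      intro k j
      have i12 : Integrable (fun ω => a₁ ω k j ^ 2 + a₂ ω k j ^ 2) μ :=
        (e₁ k j).1.add (e₂ k j).1
      rw [integral_add i12 (e₃ k j).1, integral_add (e₁ k j).1 (e₂ k j).1]
      refine (add_le_add (add_le_add (e₁ k j).2 (e₂ k j).2) (e₃ k j).2).trans ?_
      rw [← add_div, ← add_div]
      apply le_of_eq
      ring
    rw [hQ, integral_finsetSum _ fun k _ => integrable_finsetSum _ fun j _ => i123 k j]
    calc ∑ k, ∫ ω, ∑ j, (a₁ ω k j ^ 2 + a₂ ω k j ^ 2 + a₃ ω k j ^ 2) ∂μ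
        ≤ ∑ k : Fin p, ∑ j : Fin q,
            (64 + 9 / 2 * Cf ^ 4 + 256 * (1 + Cf ^ 4) ^ 2 + 33 * σ ^ 2) / n := by
          refine Finset.sum_le_sum fun k _ => ?_
          rw [integral_finsetSum _ fun j _ => i123 k j]
          exact Finset.sum_le_sum fun j _ => hkj k j
      _ = _ := by
          simp only [Finset.sum_const, Finset.card_univ, Fintype.card_fin, nsmul_eq_mul]
          ring
  · filter_upwards [hmodel.response] with ω hω
    have hy : ∀ i j, y i ω j = F j (w i ω) + e i j ω := fun i j => by
      rw [hω i j, hFdef]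
      simp only [hxw]
    have hpos : ∀ k j, 0 ≤ a₁ ω k j ^ 2 ∧ 0 ≤ a₂ ω k j ^ 2 := fun k j =>
      ⟨sq_nonneg _, sq_nonneg _⟩
    refine ⟨(frobNorm_sq_le_two_mul (a := a₁ ω) (b := a₃ ω) fun k j => ?_).trans ?_,
      (frobNorm_sq_le_two_mul (a := a₂ ω) (b := a₃ ω) fun k j => ?_).trans ?_⟩
    · simp only [Matrix.sub_apply, Matrix.smul_apply, Matrix.mul_apply, Matrix.transpose_apply,
        rowMatrix, Matrix.of_apply, smul_eq_mul, ha₁, ha₃, hy, mul_add, Finset.sum_add_distrib]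
      ring
    · refine mul_le_mul_of_nonneg_left (Finset.sum_le_sum fun k _ =>
        Finset.sum_le_sum fun j _ => ?_) zero_le_two
      linarith [hpos k j]
    · have hin : ∀ i, inner ℝ (bv j) (w i ω) = ∑ l, w i ω l * b l j := fun i => by
        rw [PiLp.inner_apply]
        simp [hbv]
      simp only [Matrix.sub_apply, Matrix.smul_apply, Matrix.mul_apply, Matrix.transpose_apply,
        rowMatrix, Matrix.of_apply, smul_eq_mul, ha₂, ha₃, hy, hin]
      rw [← mul_add, ← Finset.sum_add_distrib]
      congr 1
      refine Finset.sum_congr rfl fun i _ => ?_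
      ring
    · refine mul_le_mul_of_nonneg_left (Finset.sum_le_sum fun k _ =>
        Finset.sum_le_sum fun j _ => ?_) zero_le_two
      linarith [hpos k j]

end Model

theorem theorem3
    -- the absolute constants of the assumptions, and the exceptional probability
    (cS cB cM Cf Ch σ δ : ℝ) (hcS : 0 < cS) (hcB : 0 < cB) (hcM : 0 < cM) (hδ : 0 < δ) :
    ∃ K : ℝ, 0 < K ∧
      ∀ (n p q r : ℕ), 0 < n → 0 < q → 0 < r →
      ∀ (Ω : Type*) [MeasurableSpace Ω] (μ : Measure Ω) [IsProbabilityMeasure μ]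
        (S : Matrix (Fin p) (Fin p) ℝ) (B : Matrix (Fin p) (Fin r) ℝ)
        (f : Fin q → EuclideanSpace ℝ (Fin r) → ℝ) (ν : Measure ℝ)
        (x : Fin n → Ω → EuclideanSpace ℝ (Fin p)) (e : Fin n → Fin q → Ω → ℝ)
        (y : Fin n → Ω → Fin q → ℝ)
        (h : Fin q → EuclideanSpace ℝ (Fin r) → ℝ)
        (Bhat Bcheck : Ω → Matrix (Fin p) (Fin r) ℝ),
      -- the covariance matrix is positive definite, with smallest eigenvalue at least `cS`
      ∀ (hS : S.PosDef), (∀ i, cS ≤ hS.isHermitian.eigenvalues i) →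
      -- `B` has full column rank
      B.rank = r → cB ≤ singularValue B r →
      -- the model; the noise has finite variance
      IsModelSample μ S B f ν x e y →
      eLpNorm id 2 ν ≤ ENNReal.ofReal σ →
      -- the links are differentiable, with integrable gradient and bounded fourth moment
      (∀ j, Differentiable ℝ (f j)) →
      (∀ j, Integrable (fun u => ∇ (f j) (latent B u)) (multivariateGaussian 0 S)) →
      (∀ j, eLpNorm (fun u => f j (latent B u)) 4 (multivariateGaussian 0 S)
        ≤ ENNReal.ofReal Cf) →
      -- signal strength
      cM * √((q : ℝ) / r) ≤ singularValue (meanGradient S B f) r →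
      -- first-order Taylor expansion of the links at the origin, with bounded remainder
      (∀ j z, f j z = f j 0 + inner ℝ (∇ (f j) 0) z + h j z * ‖z‖) →
      (∀ j, Tendsto (h j) (𝓝[≠] 0) (𝓝 0)) →
      (∀ᵐ ω ∂μ, ∀ i j, |h j (latent B (x i ω))| ≤ Ch) →
      -- the two estimators
      (∀ᵐ ω ∂μ, IsFirstOrderEstimator S (fun i => x i ω) (fun i => y i ω) (Bhat ω)) →
      (∀ᵐ ω ∂μ, IsPlugInEstimator (fun i => x i ω) (fun i => y i ω) (Bcheck ω)) →
      μ {ω | K * √((r : ℝ) ^ 2 * p / n) < columnDist (Bhat ω) (Bcheck ω)} ≤ ENNReal.ofReal δ := by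
  -- `N`: observations per dimension needed for a good Gram matrix with probability `1 - δ/2`;
  -- `κ`: Markov level for the mean-square error, also at probability `1 - δ/2`
  set C₀ : ℝ := 64 + 9 / 2 * Cf ^ 4 + 256 * (1 + Cf ^ 4) ^ 2 + 33 * σ ^ 2 with hC₀
  have hC₀pos : 0 < C₀ := by positivity
  set N : ℝ := max 50 (32 / δ) with hN
  have hN50 : 50 ≤ N := le_max_left _ _
  have hNδ : 32 / δ ≤ N := le_max_right _ _
  set κ : ℝ := 2 * C₀ / δ with hκ
  have hκpos : 0 < κ := by positivity
  set K₁ : ℝ := 324 / (cB * cM * √cS) * √(2 * κ) with hK₁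
  have hK₁pos : 0 < K₁ := by positivity
  refine ⟨max (2 * √N) K₁, lt_max_of_lt_right hK₁pos, ?_⟩
  intro n p q r hn hq hr Ω _ μ _ S B f ν x e y h Bhat Bcheck hS hSeig hBrank hBsv hmodel hσ hf
    hgrad hfour hMsv _ _ _ hhat hcheck
  set K : ℝ := max (2 * √N) K₁ with hK
  have hn0 : (0 : ℝ) < n := by exact_mod_cast hn
  have hq0 : (0 : ℝ) < q := by exact_mod_cast hq
  have hr0 : (0 : ℝ) < r := by exact_mod_cast hr
  have hr1 : (1 : ℝ) ≤ r := by exact_mod_cast hr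
  have hp : 0 < p := by
    have := B.rank_le_height
    omega
  have hp0 : (0 : ℝ) < p := by exact_mod_cast hp
  have hp1 : (1 : ℝ) ≤ p := by exact_mod_cast hp
  rcases lt_or_ge (n : ℝ) (N * p) with hnp | hnp
  · -- fewer than `N p` observations: `2√r` is already below the claimed bound
    refine le_trans (le_of_eq ?_) bot_le
    refine measure_mono_null (t := {ω | ¬(IsFirstOrderEstimator S (fun i => x i ω) (fun i => y i ω)
      (Bhat ω) ∧ IsPlugInEstimator (fun i => x i ω) (fun i => y i ω) (Bcheck ω))}) ?_
      (ae_iff.1 (hhat.and hcheck))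
    rintro ω hω ⟨h₁, P, -, h₂⟩
    have h3 := columnDist_le_two_mul_sqrt h₁.orthonormal h₂.orthonormal
    have h4 : 2 * √r ≤ K * √((r : ℝ) ^ 2 * p / n) := by
      calc 2 * √(r : ℝ) ≤ 2 * √(N * ((r : ℝ) ^ 2 * p / n)) := by
            gcongr
            rw [← mul_div_assoc, le_div_iff₀ hn0]
            calc (r : ℝ) * n ≤ r * (N * p) := by gcongr
              _ = N * (r * p) * 1 := by ring
              _ ≤ N * (r * p) * r := by gcongr
              _ = N * ((r : ℝ) ^ 2 * p) := by ring
        _ = 2 * √N * √((r : ℝ) ^ 2 * p / n) := by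
            rw [Real.sqrt_mul (by linarith), mul_assoc]
        _ ≤ _ := by
            gcongr
            exact le_max_left _ _
    exact absurd (h3.trans h4) (not_le.2 hω)
  obtain ⟨R, hR, hRR, hdet, hlaw⟩ := exists_sqrt_multivariateGaussian hS
  obtain ⟨w, hw, hind, hxw, Q, hQ0, hQi, hQE, hQbound⟩ :=
    exists_whitened_errors hn hR hdet hlaw hmodel hσ hf hgrad hfour
  have hquad := hS.isHermitian.mul_dotProduct_le hSeig
  have hgram := measure_exists_sum_inner_sq_lt hw hind (by
    have : 50 * (p : ℝ) ≤ n := le_trans (by gcongr) hnp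
    exact_mod_cast this)
  have hgramδ : 2 * Real.exp (-(n / 8)) ≤ δ / 2 := by
    have h1 : 32 ≤ δ * n := by
      have : 32 / δ ≤ n := hNδ.trans (le_trans (by nlinarith) hnp)
      rwa [div_le_iff₀' hδ] at this
    have h2 : (n : ℝ) / 8 ≤ Real.exp (n / 8) := by linarith [Real.add_one_le_exp ((n : ℝ) / 8)]
    rw [Real.exp_neg, ← div_eq_mul_inv, div_le_iff₀ (Real.exp_pos _)]
    nlinarith
  set ε : ℝ := κ * (q * p / n) with hε
  have hεpos : 0 < ε := by positivity
  have hQprob : μ {ω | ε ≤ Q ω} ≤ ENNReal.ofReal (δ / 2) := by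
    have h1 := mul_meas_ge_le_integral_of_nonneg (ae_of_all μ hQ0) hQi ε
    have h2 : ε * μ.real {ω | ε ≤ Q ω} ≤ ε * (δ / 2) := by
      refine h1.trans (hQE.trans (le_of_eq ?_))
      rw [hε, hκ, ← hC₀]
      field_simp
    rw [← ofReal_measureReal]
    exact ENNReal.ofReal_le_ofReal (le_of_mul_le_mul_left h2 hεpos)
  have hsub : ({ω | K * √((r : ℝ) ^ 2 * p / n) < columnDist (Bhat ω) (Bcheck ω)} : Set Ω) ≤ᵐ[μ]
      ({ω | ∃ u, ∑ i, inner ℝ u (w i ω) ^ 2 < 1 / 80 * n * ‖u‖ ^ 2} ∪ {ω | ε ≤ Q ω} : Set Ω) := by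
    filter_upwards [hhat, hcheck, hQbound] with ω h₁ h₂ hQω hω
    by_contra hcon
    have hcon' := not_or.1 hcon
    have hG : ∀ u, 1 / 80 * (n : ℝ) * ‖u‖ ^ 2 ≤ ∑ i, inner ℝ u (w i ω) ^ 2 := fun u =>
      not_lt.1 fun hlt => hcon'.1 ⟨u, hlt⟩
    have hQlt : Q ω ≤ ε := (not_le.1 hcon'.2).le
    obtain ⟨P, hP, h₂⟩ := h₂
    set A₀ := B * meanGradient S B f with hA₀
    have t₁ := frobNorm_trueScore_sub_le (y := fun i => y i ω) hcS hS hR hRR hdet hquad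
      (fun i => hxw i ω) A₀
    have t₂ := frobNorm_plugIn_sub_le (y := fun i => y i ω) hcS (by norm_num) hR hRR hdet hquad
      (fun i => hxw i ω) hn hG hP A₀
    have hd : ∀ X : Matrix (Fin p) (Fin q) ℝ, frobNorm X ^ 2 ≤ 2 * Q ω → frobNorm X ≤ √(2 * ε) :=
      fun X hX => Real.le_sqrt_of_sq_le (by linarith)
    have u₁ := t₁.trans (hd _ hQω.1)
    have u₂ := t₂.trans (hd _ hQω.2)
    have hg : 0 < cM * √((q : ℝ) / r) := by positivity
    have hdist := columnDist_le_of_isTopLeftSingularVectors hr h₁ h₂ hcB hg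
      (singularValue_mul_le_mulVec B hcB.le hBsv)
      (singularValue_mul_le_vecMul _ hr hg hMsv)
    have hcS' : 0 < √cS := Real.sqrt_pos.2 hcS
    have v₁ : frobNorm (scoreCrossMoment (firstOrderScore (gaussianDensity S)) (fun i => x i ω)
        (fun i => y i ω) - A₀) ≤ √(2 * ε) / √cS := by
      rw [le_div_iff₀ hcS']; linarith
    have v₂ : frobNorm (scoreCrossMoment (fun u => P.toEuclideanLin u) (fun i => x i ω)
        (fun i => y i ω) - A₀) ≤ 80 * √(2 * ε) / √cS := by
      rw [le_div_iff₀ hcS']; linarith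
    have e1 : 4 * √(r : ℝ) / (cB * (cM * √((q : ℝ) / r)))
        * (√(2 * ε) / √cS + 80 * √(2 * ε) / √cS) = K₁ * √((r : ℝ) ^ 2 * p / n) := by
      have s1 : √(r : ℝ) * √(2 * ε) = √((q : ℝ) / r) * (√(2 * κ) * √((r : ℝ) ^ 2 * p / n)) := by
        rw [← Real.sqrt_mul hr0.le, ← Real.sqrt_mul (by positivity), ← Real.sqrt_mul (by positivity),
          hε]
        congr 1
        field_simp
      have s2 : √((q : ℝ) / r) ≠ 0 := by positivity
      calc 4 * √(r : ℝ) / (cB * (cM * √((q : ℝ) / r))) * (√(2 * ε) / √cS + 80 * √(2 * ε) / √cS)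
          = 324 * (√(r : ℝ) * √(2 * ε)) / (cB * cM * √cS * √((q : ℝ) / r)) := by
            field_simp
            ring
        _ = _ := by
            rw [s1, hK₁]
            field_simp
    have hfin : columnDist (Bhat ω) (Bcheck ω) ≤ K * √((r : ℝ) ^ 2 * p / n) := by
      refine hdist.trans (le_trans (mul_le_mul_of_nonneg_left (add_le_add v₁ v₂) (by positivity)) ?_)
      rw [e1]
      gcongr
      exact le_max_right _ _
    exact absurd hfin (not_le.2 hω)
  calc μ {ω | K * √((r : ℝ) ^ 2 * p / n) < columnDist (Bhat ω) (Bcheck ω)}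
      ≤ μ ({ω | ∃ u, ∑ i, inner ℝ u (w i ω) ^ 2 < 1 / 80 * n * ‖u‖ ^ 2} ∪ {ω | ε ≤ Q ω}) :=
        measure_mono_ae hsub
    _ ≤ ENNReal.ofReal (δ / 2) + ENNReal.ofReal (δ / 2) :=
        (measure_union_le _ _).trans
          (add_le_add (hgram.trans (ENNReal.ofReal_le_ofReal hgramδ)) hQprob)
    _ = ENNReal.ofReal δ := by
        rw [← ENNReal.ofReal_add (by positivity) (by positivity), add_halves]
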